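/- **Setting.** Let $d\ge 4$, $\vec n=(n_1,\dots,n_d)$, $\vec r=(r_1,\dots,r_d)$, $\tau\in S_d$, positions on the ring being read mod $d$. Let $U^{(i)}\in\mathbb R^{r_{\tau^{-1}(i)}\times n_i\times r_{\tau^{-1}(i)+1}}$ for $1\le i\le d$, and let $\mathbf T\in\mathbb R^{n_1\times\cdots\times n_d}$ be the tensor in tensor ring format $$\mathbf T(x_1,\dots,x_d)=\operatorname{tr}\big(U^{(\tau(1))}(x_{\tau(1)})\cdots U^{(\tau(d))}(x_{\tau(d)})\big),\qquad U^{(i)}(x)=U^{(i)}(:,x,:).$$ Four different indices $(i_1,i_2,i_3,i_4)$ are *of the correct order* with respect to $\tau$ if, for some cyclic shift of them, the positions $\tau^{-1}(i_s)$ are strictly increasing or strictly decreasing. For fixed values $y_i$ of the other indices, $M_{(i_1,i_2),(i_3,i_4)}$ is the $(n_{i_1}n_{i_2})\times(n_{i_3}n_{i_4})$ matrix with entries $\mathbf T(x)$, where $x_i=y_i$ for $i\notin\{i_1,\dots,i_4\}$, rows indexed by $(x_{i_1},x_{i_2})$ and columns by $(x_{i_3},x_{i_4})$; similarly for the other pairings.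 $\sigma_k(M)$ is the $k$-th largest singular value. **Algorithm 1** (input: four different indices $i_1,\dots,i_4$ and $R$). Sample $y_i\in\{1,\dots,n_i\}$ for the other indices, observe the entries of $\mathbf T$ needed to form $M_{(i_1,i_2),(i_3,i_4)}$, and rearrange them into $M_{(i_1,i_3),(i_2,i_4)}$ and $M_{(i_1,i_4),(i_2,i_3)}$. If the $R^4$-th singular value of the first, second or third of these matrices is strictly larger than those of the other two, return $(i_1,i_3,i_2,i_4)$, $(i_1,i_2,i_3,i_4)$ or $(i_1,i_2,i_4,i_3)$, respectively. (Otherwise nothing is returned.) **Algorithm 2** (input: $R$). Let $(i_1,i_2,i_3,i_4)$ be the output of Algorithm 1 on $1,2,3,4$. For $t=4,\dots,d-1$: set $j_{\min}=1$, $j_{\max}=t+1$; while $D:=j_{\max}-j_{\min}\ge2$, put $(j_1,j_2,j_3)=(j_{\min},\,j_{\min}+\lfloor D/3\rfloor,\,j_{\min}+\lfloor 2D/3\rfloor)$ if $D\ge3$, $(j_1,j_2,j_3)=(j_{\min},j_{\min}+1,j_{\max})$ if $D=2$ and $j_{\max}\le t$, and $(j_1,j_2,j_3)=(1,t-1,t)$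 otherwise; run Algorithm 1 on $t+1,i_{j_1},i_{j_2},i_{j_3}$; if its output agrees up to rotation and reflection with $(i_{j_1},t+1,i_{j_2},i_{j_3})$, set $(j_{\min},j_{\max})=(j_1,j_2)$; else if it so agrees with $(i_{j_1},i_{j_2},t+1,i_{j_3})$, set $(j_{\min},j_{\max})=(j_2,j_3)$; else set $j_{\min}=j_3$. After the while loop, replace $(i_1,\dots,i_t)$ by $(i_1,\dots,i_{j_{\min}},t+1,i_{j_{\max}},\dots,i_t)$. Finally return $\tau'$ with $\tau'(j)=i_j$. The result is *correct* if $\tau'=\tau\circ\alpha^k\circ\beta^\ell$ for some $0\le k<d$ and $\ell\in\{0,1\}$, where $\alpha(j)=j+1$ (mod $d$) and $\beta(j)=d+1-j$. It is *incorrect* otherwise, in particular if some run of Algorithm 1 returns nothing or no permutation results. **Assumptions.** $R\ge1$, $\min_i n_i\ge R^2>\max_j r_j$ and $\min_j r_j\ge R$. There is $\sigma>0$ with $\sigma_{R^4}(M_{(i_1,i_3),(i_2,i_4)})\ge\sigma$ for all $(i_1,i_2,i_3,i_4)$ of the correct order with respect to $\tau$ and all $y$. Let $\sigma_e>0$. In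 each run of Algorithm 1 the observations of the entries of $\mathbf T$ carry independent additive $\mathcal N(0,\sigma_e^2)$ noise, and the sample $y$ (which may have any distribution, and may be deterministic) is independent of that noise. Nothing is assumed on the dependence between different runs, so the noise may be fresh in every run, or attached once and for all to each entry of $\mathbf T$. **Claim.** There is an absolute constant $C>0$ such that in this setting, for every real $T<\sigma/\sigma_e$, the probability that Algorithm 2 returns an incorrect ordering is at most $$C\,d\log d\cdot\exp\Big(-\tfrac18\max\{T-4n_{\max},0\}^2\Big),\qquad n_{\max}=\max_{1\le i\le d}n_i.$$ -/

import Mathlib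

namespace TensorRing

/-- Real tensors of order `d` with physical dimensions `n 0, …, n (d - 1)`. -/
abbrev Tensor {d : ℕ} (n : Fin d → ℕ) : Type :=
  (∀ i, Fin (n i)) → ℝ

/-- Collections of `3`-tensors `u i ∈ ℝ ^ (r (τ⁻¹ i) × n i × r (τ⁻¹ i + 1))`, `i : Fin d`,
where `+ 1` is taken modulo `d`: the node `i` sits at position `τ⁻¹ i` on the ring, and the bond
`r j` joins the positions `j - 1` and `j`. -/
abbrev Cores {d : ℕ} (n r : Fin d → ℕ) (τ : Equiv.Perm (Fin d)) : Type :=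
  ∀ i, Fin (r (τ.symm i)) → Fin (n i) → Fin (r (finRotate d (τ.symm i))) → ℝ

/-- The tensor in tensor ring format given by the cores `u` and the permutation `τ`. The entry at
`x` is the trace of `u (τ 0) (x (τ 0)) * u (τ 1) (x (τ 1)) * ⋯ * u (τ (d - 1)) (x (τ (d - 1)))`,
written as a sum over all values `k` of the bond indices. -/
def ringTensor {d : ℕ} {n r : Fin d → ℕ} {τ : Equiv.Perm (Fin d)} (u : Cores n r τ) : Tensor n :=
  fun x => ∑ k : (∀ j, Fin (r j)),
    ∏ i, u i (k (τ.symm i)) (x i) (k (finRotate d (τ.symm i)))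

/-- The matrix with rows indexed by `(x a, x b)`, columns by `(x c, x e)`, and entries those
of `X`, where every index other than `a, b, c, e` is frozen at its value in `y`. (The
values of `y` at `a, b, c, e` play no role.) -/
def matricization {d : ℕ} {n : Fin d → ℕ} (X : Tensor n) (y : ∀ i, Fin (n i)) (a b c e : Fin d) :
    Matrix (Fin (n a) × Fin (n b)) (Fin (n c) × Fin (n e)) ℝ :=
  Matrix.of fun p q =>
    X (Function.update (Function.update (Function.update (Function.update y a p.1) b p.2) c q.1)
      e q.2)

/-- The `k`-th largest singular value of a matrix, for `k ≥ 1` (zero when `k` exceeds the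
dimensions of the matrix). -/
noncomputable def singularValue {ι κ : Type} [Fintype ι] [Fintype κ] [DecidableEq κ]
    (M : Matrix ι κ ℝ) (k : ℕ) : ℝ :=
  (Matrix.toEuclideanLin M).singularValues (k - 1)

/-- The four indices `q 0, q 1, q 2, q 3` are visited in this order by a walk around the ring, in
one of the two directions. Addition in `Fin 4` is modulo `4`. -/
def CorrectOrder {d : ℕ} (τ : Equiv.Perm (Fin d)) (q : Fin 4 → Fin d) : Prop :=
  ∃ s : Fin 4,
    (τ.symm (q s) < τ.symm (q (s + 1)) ∧ τ.symm (q (s + 1)) < τ.symm (q (s + 2)) ∧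
      τ.symm (q (s + 2)) < τ.symm (q (s + 3))) ∨
    (τ.symm (q s) > τ.symm (q (s + 1)) ∧ τ.symm (q (s + 1)) > τ.symm (q (s + 2)) ∧
      τ.symm (q (s + 2)) > τ.symm (q (s + 3)))

/-- `τ'` describes the same ring as `τ`: it is `τ ∘ α ^ k ∘ β ^ ℓ` with the
rotation `α j = j + 1` and the reflection `β j = d - 1 - j` of positions. -/
def SameRing {d : ℕ} (τ τ' : Equiv.Perm (Fin d)) : Prop :=
  ∃ k < d, ∃ ℓ < 2, τ' = τ * finRotate d ^ k * (Fin.revPerm : Equiv.Perm (Fin d)) ^ ℓ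

/-- Two cyclic arrangements of four indices agree up to rotation and reflection. -/
def CyclicEquiv {α : Type} (q q' : Fin 4 → α) : Prop :=
  ∃ k : Fin 4, (∀ s, q s = q' (k + s)) ∨ (∀ s, q s = q' (k - s))

instance {α : Type} [DecidableEq α] (q q' : Fin 4 → α) : Decidable (CyclicEquiv q q') :=
  inferInstanceAs (Decidable (∃ k : Fin 4, (∀ s, q s = q' (k + s)) ∨ (∀ s, q s = q' (k - s))))

open Classical in
/-- The algorithm ordering four indices `q 0, q 1, q 2, q 3`, run on observed entries `X` of the
tensor, with sampled values `y` of the other indices. The result is `none` if no one of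
the three singular values is strictly the largest. -/
noncomputable def orderFour {d : ℕ} {n : Fin d → ℕ} (R : ℕ) (X : Tensor n) (y : ∀ i, Fin (n i))
    (q : Fin 4 → Fin d) : Option (Fin 4 → Fin d) :=
  let s₁ := singularValue (matricization X y (q 0) (q 1) (q 2) (q 3)) (R ^ 4)
  let s₂ := singularValue (matricization X y (q 0) (q 2) (q 1) (q 3)) (R ^ 4)
  let s₃ := singularValue (matricization X y (q 0) (q 3) (q 1) (q 2)) (R ^ 4)
  if s₁ > max s₂ s₃ then some ![q 0, q 2, q 1, q 3]
  else if s₂ > max s₁ s₃ then some ![q 0, q 1, q 2, q 3]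
  else if s₃ > max s₁ s₂ then some ![q 0, q 1, q 3, q 2]
  else none

/-- The probe positions `j₁, j₂, j₃` (counted from `1`) of the search among `t` ordered indices. -/
def probes (t jmin jmax : ℕ) : ℕ × ℕ × ℕ :=
  if 3 ≤ jmax - jmin then (jmin, jmin + (jmax - jmin) / 3, jmin + 2 * (jmax - jmin) / 3)
  else if jmax ≤ t then (jmin, jmin + 1, jmax)
  else (1, t - 1, t)

/-- The inner loop, which searches for the place of `x` in the list `l` of `t` indices; it
returns the final `(jmin, jmax)`. Positions in `l` are counted from `1`. `ask (t, s)` is the call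
of the algorithm for four indices that is made in pass `s` of this loop. The first argument bounds
the number of passes, and the result is `none` if it is exceeded, or if some
call returns nothing. -/
def searchLoop {d : ℕ} (ask : ℕ × ℕ → (Fin 4 → Fin d) → Option (Fin 4 → Fin d))
    (t : ℕ) (x : Fin d) (l : List (Fin d)) : ℕ → ℕ → ℕ → ℕ → Option (ℕ × ℕ)
  | 0, _, jmin, jmax => if 2 ≤ jmax - jmin then none else some (jmin, jmax)
  | passes + 1, s, jmin, jmax =>
    if 2 ≤ jmax - jmin then do
      let j := probes t jmin jmax
      let a ← l[j.1 - 1]?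
      let b ← l[j.2.1 - 1]?
      let c ← l[j.2.2 - 1]?
      let out ← ask (t, s) ![x, a, b, c]
      if CyclicEquiv out ![a, x, b, c] then searchLoop ask t x l passes (s + 1) j.1 j.2.1
      else if CyclicEquiv out ![a, b, x, c] then searchLoop ask t x l passes (s + 1) j.2.1 j.2.2
      else searchLoop ask t x l passes (s + 1) j.2.2 jmax
    else some (jmin, jmax)

/-- One pass of the outer loop: `x`, the first index not yet ordered, is inserted into the
list `l` of the `t = x` smaller ones, which becomes
`i₁, …, i_jmin, x, i_jmax, i_(jmax+1), …, i_t`. The inner loop never needs more than `2 * t`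
passes. -/
def insertNext {d : ℕ} (ask : ℕ × ℕ → (Fin 4 → Fin d) → Option (Fin 4 → Fin d))
    (l : List (Fin d)) (x : Fin d) : Option (List (Fin d)) := do
  let t := (x : ℕ)
  let j ← searchLoop ask t x l (2 * t) 0 1 (t + 1)
  return l.take j.1 ++ [x] ++ l.drop (j.2 - 1)

/-- The algorithm recovering the order of all `d` indices: order the first four, then insert the
other ones one after the other. Calls of the algorithm `ask` for four indices are labelled:
`(0, 0)` is the initial call, and `(t, s)` is the call in pass `s` of the search for the place of
the index `t`. The result is the list `τ' 0, …, τ' (d - 1)`, or `none` if the run fails. -/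
def recoverRing {d : ℕ} (hd : 4 ≤ d)
    (ask : ℕ × ℕ → (Fin 4 → Fin d) → Option (Fin 4 → Fin d)) : Option (List (Fin d)) := do
  let q ← ask (0, 0) fun s => Fin.castLE hd s
  ((List.finRange d).drop 4).foldlM (insertNext ask) (List.ofFn q)

/-- The output describes the ring of `τ`: it lists the values of some permutation in the class
of `τ`. -/
def IsCorrectOutput {d : ℕ} (τ : Equiv.Perm (Fin d)) (out : Option (List (Fin d))) : Prop :=
  ∃ τ' : Equiv.Perm (Fin d), SameRing τ τ' ∧ out = some (List.ofFn τ')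

/-- The whole algorithm, run on noisy observations: the call with label `c` uses the sampled
values `y c` and observes each entry of `T` with additive noise `E c`. -/
noncomputable def noisyRun {d : ℕ} (hd : 4 ≤ d) {n : Fin d → ℕ} (R : ℕ) (T : Tensor n)
    (y : ℕ × ℕ → ∀ i, Fin (n i)) (E : ℕ × ℕ → Tensor n) : Option (List (Fin d)) :=
  recoverRing hd fun c q => orderFour R (T + E c) (y c) q

/-- The input `R` approximates the bond dimensions `r` and is small compared with the physical
dimensions `n`. -/
def AdmissibleRank {d : ℕ} (n r : Fin d → ℕ) (R : ℕ) : Prop :=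
  0 < R ∧ (∀ i, R ^ 2 ≤ n i) ∧ (∀ j, r j < R ^ 2) ∧ ∀ j, R ≤ r j

/-- For every four indices in correct order, and all values of the other indices, the matricization
that separates neighbours has its `R ^ 4`-th singular value bounded below by `σ`. -/
def UniformGap {d : ℕ} {n r : Fin d → ℕ} {τ : Equiv.Perm (Fin d)} (u : Cores n r τ) (R : ℕ)
    (σ : ℝ) : Prop :=
  ∀ q : Fin 4 → Fin d, CorrectOrder τ q → ∀ y : ∀ i, Fin (n i),
    σ ≤ singularValue (matricization (ringTensor u) y (q 0) (q 2) (q 1) (q 3)) (R ^ 4)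

end TensorRing

/-! Cutting the ring at two bonds factors the tensor through a space of dimension `r lo * r hi < R ^
4`. Of the three ways to split four indices into two pairs, the two that pair neighbours are
separated by such a cut, so their `R ^ 4`-th singular values vanish, while for the crossing pairing
this singular value is at least `σ` by hypothesis. By Weyl's inequality, noise of operator norm at
most `s < σ / 2` in all three matricizations does not change which of them wins
(`orderFour_eq_exactAnswer`).

The noise in one matricization is `σe` times a standard Gaussian matrix whose sides are at most
`n_max ^ 2`. The Davidson–Szarek inequality (`gaussianPi_opNorm_gt_le`) bounds its norm by `σe * (2
* n_max + t)` outside an event of probability `exp (-t ^ 2 / 2)`. It is reached through exponential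
moments: Gaussian interpolation with Stein's identity gives Slepian's comparison
(`integral_expSum_rpow_le`), which bounds the bilinear form of a Gaussian matrix by the norms of two
independent Gaussian vectors (`integral_exp_bilinear_le`); a sharp moment bound for these norms and
Markov's inequality finish. The choice `t = T / 2 - 2 * n_max` makes twice the threshold equal to
`σe * T < σ`, and turns `t ^ 2 / 2` into `(T - 4 * n_max) ^ 2 / 8`.

If every answer is exact, each insertion at least halves a dyadic bound on the search interval per
pass, so the whole run takes `O(d log d)` queries (`computes_recoverRing`). The queries of the exact
run form a set `Q` fixed in advance, independent of the noise. Whenever all of `Q` is answered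
exactly, the adaptive run follows the exact one. A union bound over `Q` is therefore enough, and no
assumption on the dependence between calls is needed. -/

section

open MeasureTheory ProbabilityTheory Module
open scoped RealInnerProductSpace ENNReal NNReal

/-! ### The standard Gaussian measure and Stein's identity. -/

section StdGaussian

variable {E : Type*} [NormedAddCommGroup E] [InnerProductSpace ℝ E] [FiniteDimensional ℝ E]
  [MeasurableSpace E] [BorelSpace E]

/-- The density of the standard Gaussian measure, up to normalization. -/
theorem integrable_exp_neg_half_norm_sq :
    Integrable (fun x : E => Real.exp (-(‖x‖ ^ 2 / 2))) := by
  have h := (GaussianFourier.integrable_cexp_neg_mul_sq_norm_add (V := E) (b := 1/2)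
    (by norm_num) 0 0).re
  refine h.congr (Filter.Eventually.of_forall fun x => ?_)
  simp only [zero_mul, add_zero]
  have : (-(1/2 : ℂ) * (‖x‖:ℂ) ^ 2) = ((-(‖x‖ ^ 2 / 2) : ℝ) : ℂ) := by push_cast; ring
  rw [this, ← Complex.ofReal_exp]; exact Complex.ofReal_re _

/-- Characteristic functions determine the measure. The Gaussian Fourier integral is taken once with
the oscillating factor and once without; their quotient is `exp (-‖t‖ ^ 2 / 2)`, so the normalizing
constant never has to be computed. -/
theorem stdGaussian_eq_withDensity :
    ∃ c : ℝ, stdGaussian E =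
      volume.withDensity (fun x : E => ENNReal.ofReal (c * Real.exp (-(‖x‖ ^ 2 / 2)))) ∧ 0 ≤ c := by
  have hpos : 0 < ∫ x : E, Real.exp (-(‖x‖ ^ 2 / 2)) :=
    integral_exp_pos integrable_exp_neg_half_norm_sq
  set c : ℝ := (∫ x : E, Real.exp (-(‖x‖ ^ 2 / 2)))⁻¹ with hc
  refine ⟨c, ?_, by positivity⟩
  have hfin : IsFiniteMeasure (volume.withDensity
      (fun x : E => ENNReal.ofReal (c * Real.exp (-(‖x‖ ^ 2 / 2))))) :=
    isFiniteMeasure_withDensity_ofReal (integrable_exp_neg_half_norm_sq.const_mul c).2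
  refine Measure.ext_of_charFun (funext fun t => ?_)
  rw [charFun_stdGaussian, charFun_apply, integral_withDensity_eq_integral_toReal_smul (by fun_prop)
    (by simp)]
  have h1 := GaussianFourier.integral_cexp_neg_mul_sq_norm_add (V := E) (b := 1/2)
    (by norm_num) Complex.I t
  have h2 := GaussianFourier.integral_cexp_neg_mul_sq_norm_add (V := E) (b := 1/2)
    (by norm_num) 0 t
  have key : ∀ x : E, Complex.exp (-(1/2 : ℂ) * (‖x‖:ℂ) ^ 2) =
      ((Real.exp (-(‖x‖ ^ 2 / 2)) : ℝ) : ℂ) := by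
    intro x; push_cast; congr 1; ring
  simp only [zero_mul, add_zero] at h2
  simp_rw [key] at h2
  rw [integral_complex_ofReal] at h2
  have e1 : ∀ x : E, (ENNReal.ofReal (c * Real.exp (-(‖x‖ ^ 2 / 2)))).toReal •
      Complex.exp ((⟪x, t⟫ : ℝ) * Complex.I) =
      (c : ℂ) * Complex.exp (-(1/2 : ℂ) * (‖x‖:ℂ) ^ 2 + Complex.I * (⟪t, x⟫ : ℝ)) := by
    intro x
    rw [ENNReal.toReal_ofReal (by positivity), Complex.exp_add, key, Complex.real_smul,
      real_inner_comm, mul_comm Complex.I]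
    push_cast; ring
  simp_rw [e1]
  rw [integral_const_mul, h1]
  have e2 : (0:ℂ) ^ 2 * (‖t‖:ℂ) ^ 2 / (4 * (1/2)) = 0 := by simp
  rw [e2, Complex.exp_zero, mul_one] at h2
  rw [← h2, ← mul_assoc, hc]
  rw [Complex.ofReal_inv, inv_mul_cancel₀ (by exact_mod_cast hpos.ne'), one_mul]
  congr 1
  rw [Complex.I_sq]; ring

/-- Fernique's theorem makes some `exp (C * ‖x‖ ^ 2)` integrable, and completing the square
dominates the linear exponent by the quadratic one. All later dominations rest on this. -/
theorem integrable_exp_mul_norm_stdGaussian (c : ℝ) :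
    Integrable (fun x : E => Real.exp (c * ‖x‖)) (stdGaussian E) := by
  obtain ⟨C, hC, h⟩ := IsGaussian.exists_integrable_exp_sq (stdGaussian E)
  refine (h.const_mul (Real.exp (c ^ 2 / (4 * C)))).mono' (by fun_prop)
    (Filter.Eventually.of_forall fun x => ?_)
  rw [Real.norm_eq_abs, abs_of_pos (Real.exp_pos _), ← Real.exp_add, Real.exp_le_exp]
  have : c ^ 2 / (4 * C) + C * ‖x‖ ^ 2 - c * ‖x‖ = C * (‖x‖ - c / (2 * C)) ^ 2 := by
    field_simp; ring
  nlinarith [mul_nonneg hC.le (sq_nonneg (‖x‖ - c / (2 * C)))]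

/-- **Stein's identity** for the standard Gaussian measure. -/
theorem integral_inner_mul_stdGaussian {f : E → ℝ} (hf : Differentiable ℝ f) (v : E)
    (hfi : Integrable f (stdGaussian E))
    (hfv : Integrable (fun x => ⟪v, x⟫ * f x) (stdGaussian E))
    (hf' : Integrable (fun x => fderiv ℝ f x v) (stdGaussian E)) :
    ∫ x, ⟪v, x⟫ * f x ∂(stdGaussian E) = ∫ x, fderiv ℝ f x v ∂(stdGaussian E) := by
  obtain ⟨c, hc, hc0⟩ := stdGaussian_eq_withDensity (E := E)
  set g : E → ℝ := fun x => c * Real.exp (-(‖x‖ ^ 2 / 2)) with hg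
  have hgpos : ∀ x, 0 ≤ g x := fun x => by positivity
  have hgm : Measurable fun x => ENNReal.ofReal (g x) := by fun_prop
  have hI : ∀ F : E → ℝ, ∫ x, F x ∂(stdGaussian E) = ∫ x, F x * g x := by
    intro F
    rw [hc, integral_withDensity_eq_integral_toReal_smul hgm (by simp)]
    refine integral_congr_ae (Filter.Eventually.of_forall fun x => ?_)
    simp only [smul_eq_mul]
    rw [ENNReal.toReal_ofReal (hgpos x), mul_comm]
  have hJ : ∀ F : E → ℝ, Integrable F (stdGaussian E) → Integrable (fun x => F x * g x) := by
    intro F hF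
    rw [hc, integrable_withDensity_iff hgm (by simp)] at hF
    refine hF.congr (Filter.Eventually.of_forall fun x => ?_)
    simp only [ENNReal.toReal_ofReal (hgpos x)]
  have hgd : ∀ x, HasFDerivAt g (-(g x) • innerSL ℝ x) x := by
    intro x
    have h1 := ((hasStrictFDerivAt_norm_sq x).hasFDerivAt.const_mul (1/2)).neg.exp.const_mul c
    convert! h1 using 1
    · ext y; simp only [hg, Pi.neg_apply]; ring_nf
    · ext y; simp [hg]; ring_nf
  -- The factor `⟪v, x⟫` is minus the logarithmic derivative of the density, so the identity is
  -- integration by parts for Lebesgue measure.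
  have hgder : ∀ x, fderiv ℝ g x v = -(⟪v, x⟫ * g x) := by
    intro x
    rw [(hgd x).fderiv]; simp [real_inner_comm]; ring
  have := integral_mul_fderiv_eq_neg_fderiv_mul_of_integrable (μ := (volume : Measure E))
    (f := f) (g := g) (v := v) (hJ _ hf')
    (by
      have := (hJ _ hfv).neg
      refine this.congr (Filter.Eventually.of_forall fun x => ?_)
      simp only [hgder, Pi.neg_apply]; ring) (hJ _ hfi) (fun x _ => hf x)
      (fun x _ => (hgd x).differentiableAt)
  rw [hI, hI]
  have h2 : ∀ x, f x * fderiv ℝ g x v = -(⟪v, x⟫ * f x * g x) := fun x => by rw [hgder]; ring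
  simp_rw [h2, integral_neg] at this
  exact neg_injective this

end StdGaussian

end

/-! ### Powers of sums of exponentials and Slepian's comparison. -/

section

open MeasureTheory ProbabilityTheory Module
open scoped RealInnerProductSpace ENNReal NNReal

section SoftMax

variable {E : Type*} [NormedAddCommGroup E] [InnerProductSpace ℝ E]
  {K : Type*} [Fintype K]

/-- The sum of the exponentials of `β ⟪w k, x⟫`. -/
noncomputable def expSum (β : ℝ) (w : K → E) (x : E) : ℝ :=
  ∑ k, Real.exp (β * ⟪w k, x⟫)

variable (β : ℝ) (w : K → E) (x : E)

theorem exp_le_expSum (k : K) : Real.exp (β * ⟪w k, x⟫) ≤ expSum β w x :=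
  Finset.single_le_sum (f := fun k => Real.exp (β * ⟪w k, x⟫)) (fun _ _ => (Real.exp_pos _).le)
    (Finset.mem_univ k)

theorem expSum_nonneg : 0 ≤ expSum β w x :=
  Finset.sum_nonneg fun _ _ => (Real.exp_pos _).le

theorem expSum_pos [Nonempty K] : 0 < expSum β w x :=
  Finset.sum_pos (fun _ _ => Real.exp_pos _) Finset.univ_nonempty

theorem expSum_le {β : ℝ} (hβ : 0 ≤ β) {M : ℝ} (hM : ∀ k, ‖w k‖ ≤ M) :
    expSum β w x ≤ Fintype.card K * Real.exp (β * M * ‖x‖) := by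
  have : expSum β w x ≤ ∑ _k : K, Real.exp (β * M * ‖x‖) := by
    refine Finset.sum_le_sum fun k _ => Real.exp_le_exp.2 ?_
    rw [mul_assoc]
    exact mul_le_mul_of_nonneg_left ((real_inner_le_norm _ _).trans
      (mul_le_mul_of_nonneg_right (hM k) (norm_nonneg _))) hβ
  simpa using this

/-- A bound for powers of the sum of exponentials, of exponential growth. -/
theorem expSum_rpow_le [Nonempty K] {β p : ℝ} (hβ : 0 ≤ β) (hp : 0 ≤ p) (hp1 : p ≤ 1) {M : ℝ}
    (hM : ∀ k, ‖w k‖ ≤ M) :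
    expSum β w x ^ p ≤ 1 + Fintype.card K * Real.exp (β * M * ‖x‖) := by
  have hS := expSum_pos β w x
  have h1 : expSum β w x ^ p ≤ 1 + expSum β w x := by
    rcases le_total (expSum β w x) 1 with h | h
    · exact (Real.rpow_le_one hS.le h hp).trans (by linarith)
    · calc expSum β w x ^ p ≤ expSum β w x ^ (1:ℝ) := Real.rpow_le_rpow_of_exponent_le h hp1
        _ ≤ 1 + expSum β w x := by rw [Real.rpow_one]; linarith
  linarith [expSum_le w x hβ hM]

theorem hasFDerivAt_expSum :
    HasFDerivAt (expSum β w) (∑ k, (β * Real.exp (β * ⟪w k, x⟫)) • innerSL ℝ (w k)) x := by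
  unfold expSum
  refine HasFDerivAt.fun_sum fun k _ => ?_
  have h := (((innerSL ℝ (w k)).hasFDerivAt (x := x)).const_mul β).exp
  convert! h using 1
  ext y; simp; ring

/-- The numerator of the derivative of a power of `expSum` in one of the arguments. -/
noncomputable def softTerm (β p : ℝ) (w : K → E) (k : K) (x : E) : ℝ :=
  expSum β w x ^ (p - 1) * Real.exp (β * ⟪w k, x⟫)

theorem softTerm_nonneg (p : ℝ) (k : K) : 0 ≤ softTerm β p w k x :=
  mul_nonneg (Real.rpow_nonneg (expSum_nonneg β w x) _) (Real.exp_pos _).le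

theorem softTerm_le [Nonempty K] (p : ℝ) (k : K) : softTerm β p w k x ≤ expSum β w x ^ p := by
  have hS := expSum_pos β w x
  calc softTerm β p w k x ≤ expSum β w x ^ (p - 1) * expSum β w x :=
        mul_le_mul_of_nonneg_left (exp_le_expSum β w x k) (Real.rpow_nonneg hS.le _)
    _ = expSum β w x ^ p := by
        rw [Real.rpow_sub_one hS.ne']; field_simp

/-- The coefficients are written with the weights `exp / expSum`, which are at most one; the
derivative is then dominated by multiples of `softTerm` itself. -/
theorem hasFDerivAt_softTerm [Nonempty K] (p : ℝ) (k : K) :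
    HasFDerivAt (softTerm β p w k)
      (∑ l, (β * (p - 1) * (softTerm β p w k x * (Real.exp (β * ⟪w l, x⟫) / expSum β w x))) •
        innerSL ℝ (w l) + (β * softTerm β p w k x) • innerSL ℝ (w k)) x := by
  have hS := expSum_pos β w x
  have h1 := (hasFDerivAt_expSum β w x).rpow_const (p := p - 1) (Or.inl hS.ne')
  have h2 := (((innerSL ℝ (w k)).hasFDerivAt (x := x)).const_mul β).exp
  have h3 := h1.mul h2
  unfold softTerm
  convert! h3 using 1
  ext y
  simp only [add_apply, sum_apply,
    smul_apply, innerSL_apply_apply, smul_eq_mul, Finset.mul_sum]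
  rw [add_comm]
  congr 1
  · ring
  · refine Finset.sum_congr rfl fun l _ => ?_
    rw [Real.rpow_sub_one hS.ne' (p - 1)]
    field_simp

theorem continuous_expSum_rpow [Nonempty K] (p : ℝ) : Continuous fun x => expSum β w x ^ p :=
  continuous_iff_continuousAt.2 fun x =>
    ((hasFDerivAt_expSum β w x).rpow_const (Or.inl (expSum_pos β w x).ne')).continuousAt

variable [FiniteDimensional ℝ E] [MeasurableSpace E] [BorelSpace E]

theorem integrable_norm_mul_exp_growth (A B c : ℝ) :
    Integrable (fun x : E => ‖x‖ * (A + B * Real.exp (c * ‖x‖))) (stdGaussian E) := by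
  have h : Integrable (fun x : E => |A| * Real.exp (1 * ‖x‖) + |B| * Real.exp ((c + 1) * ‖x‖))
      (stdGaussian E) :=
    ((integrable_exp_mul_norm_stdGaussian 1).const_mul _).add
      ((integrable_exp_mul_norm_stdGaussian (c + 1)).const_mul _)
  refine h.mono' (by fun_prop) (Filter.Eventually.of_forall fun x => ?_)
  have h1 : ‖x‖ ≤ Real.exp (1 * ‖x‖) := by
    rw [one_mul]; linarith [Real.add_one_le_exp ‖x‖]
  have h2 : Real.exp ((c + 1) * ‖x‖) = Real.exp (1 * ‖x‖) * Real.exp (c * ‖x‖) := by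
    rw [← Real.exp_add]; ring_nf
  rw [h2, norm_mul, norm_norm, Real.norm_eq_abs]
  calc ‖x‖ * |A + B * Real.exp (c * ‖x‖)|
      ≤ Real.exp (1 * ‖x‖) * (|A| + |B| * Real.exp (c * ‖x‖)) := by
        refine mul_le_mul h1 ?_ (abs_nonneg _) (Real.exp_pos _).le
        refine (abs_add_le _ _).trans ?_
        rw [abs_mul, abs_of_pos (Real.exp_pos _)]
    _ = _ := by ring

theorem integrable_const_exp_growth (A B c : ℝ) :
    Integrable (fun x : E => A + B * Real.exp (c * ‖x‖)) (stdGaussian E) :=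
  (integrable_const A).add ((integrable_exp_mul_norm_stdGaussian c).const_mul B)

theorem integrable_expSum_rpow [Nonempty K] {β p : ℝ} (hβ : 0 ≤ β) (hp : 0 ≤ p) (hp1 : p ≤ 1) :
    Integrable (fun x => expSum β w x ^ p) (stdGaussian E) := by
  refine (integrable_const_exp_growth 1 (Fintype.card K) (β * ∑ k, ‖w k‖)).mono'
    (continuous_expSum_rpow β w p).aestronglyMeasurable (Filter.Eventually.of_forall fun x => ?_)
  rw [Real.norm_eq_abs, abs_of_nonneg (Real.rpow_nonneg (expSum_nonneg β w x) _)]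
  exact expSum_rpow_le w x hβ hp hp1 fun k =>
    Finset.single_le_sum (f := fun k => ‖w k‖) (fun _ _ => norm_nonneg _) (Finset.mem_univ k)

/-- Integration by parts in the direction `v`, orthogonal to `w k`. -/
theorem integral_inner_mul_softTerm [Nonempty K] {β p : ℝ} (hβ : 0 ≤ β) (hp : 0 ≤ p) (hp1 : p ≤ 1)
    (k : K) (v : E) (hv : ⟪w k, v⟫ = 0) (hl : ∀ l, ⟪w l, v⟫ ≤ 0) :
    0 ≤ ∫ x, ⟪v, x⟫ * softTerm β p w k x ∂(stdGaussian E) := by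
  set M := ∑ k, ‖w k‖ with hM
  have hMk : ∀ k, ‖w k‖ ≤ M := fun k =>
    Finset.single_le_sum (f := fun k => ‖w k‖) (fun _ _ => norm_nonneg _) (Finset.mem_univ k)
  have hdiff : Differentiable ℝ (softTerm β p w k) := fun x =>
    (hasFDerivAt_softTerm β w x p k).differentiableAt
  have hb : ∀ x, softTerm β p w k x ≤ 1 + Fintype.card K * Real.exp (β * M * ‖x‖) := fun x =>
    (softTerm_le β w x p k).trans (expSum_rpow_le w x hβ hp hp1 hMk)
  have hfd : ∀ x, fderiv ℝ (softTerm β p w k) x v =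
      ∑ l, (β * (p - 1) * ⟪w l, v⟫) *
        (softTerm β p w k x * (Real.exp (β * ⟪w l, x⟫) / expSum β w x)) := by
    intro x
    rw [(hasFDerivAt_softTerm β w x p k).fderiv]
    simp only [add_apply, sum_apply,
      smul_apply, innerSL_apply_apply, smul_eq_mul, hv, mul_zero, add_zero]
    exact Finset.sum_congr rfl fun l _ => by ring
  have hint : Integrable (softTerm β p w k) (stdGaussian E) := by
    refine (integrable_const_exp_growth 1 (Fintype.card K) (β * M)).mono'
      hdiff.continuous.aestronglyMeasurable (Filter.Eventually.of_forall fun x => ?_)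
    rw [Real.norm_eq_abs, abs_of_nonneg (softTerm_nonneg β w x p k)]
    exact hb x
  -- After Stein's identity, orthogonality of `v` to `w k` removes the derivative of the single
  -- exponential. The remaining coefficients contain the product of `p - 1` and `⟪w l, v⟫`, both
  -- nonpositive; this is where `p ≤ 1` enters.
  rw [integral_inner_mul_stdGaussian hdiff v hint]
  · simp_rw [hfd]
    refine integral_nonneg fun x => Finset.sum_nonneg fun l _ => mul_nonneg ?_ ?_
    · have : 0 ≤ (1 - p) * -⟪w l, v⟫ := mul_nonneg (by linarith) (by linarith [hl l])
      nlinarith [mul_nonneg hβ this]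
    · exact mul_nonneg (softTerm_nonneg β w x p k)
        (div_nonneg (Real.exp_pos _).le (expSum_nonneg β w x))
  · refine ((integrable_norm_mul_exp_growth 1 (Fintype.card K) (β * M)).const_mul ‖v‖).mono'
      ((continuous_const.inner continuous_id).mul hdiff.continuous).aestronglyMeasurable
      (Filter.Eventually.of_forall fun x => ?_)
    rw [norm_mul, ← mul_assoc]
    refine mul_le_mul (norm_inner_le_norm _ _) ?_ (norm_nonneg _) (by positivity)
    rw [Real.norm_eq_abs, abs_of_nonneg (softTerm_nonneg β w x p k)]
    exact hb x
  · simp_rw [hfd]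
    refine integrable_finsetSum _ fun l _ => Integrable.const_mul ?_ _
    have hcont : Continuous fun x => softTerm β p w k x *
        (Real.exp (β * ⟪w l, x⟫) / expSum β w x) := by
      refine hdiff.continuous.mul (Continuous.div ?_ ?_ fun x => (expSum_pos β w x).ne')
      · fun_prop
      · exact continuous_iff_continuousAt.2 fun x => (hasFDerivAt_expSum β w x).continuousAt
    refine hint.mono' hcont.aestronglyMeasurable (Filter.Eventually.of_forall fun x => ?_)
    have h0 := softTerm_nonneg β w x p k
    have h1 : Real.exp (β * ⟪w l, x⟫) / expSum β w x ≤ 1 :=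
      (div_le_one (expSum_pos β w x)).2 (exp_le_expSum β w x l)
    have h2 : 0 ≤ Real.exp (β * ⟪w l, x⟫) / expSum β w x :=
      div_nonneg (Real.exp_pos _).le (expSum_nonneg β w x)
    rw [Real.norm_eq_abs, abs_of_nonneg (mul_nonneg h0 h2)]
    exact mul_le_of_le_one_right h0 h1

/-- **Slepian's inequality** in exponential form, by Gaussian interpolation: enlarging the
distances between the vectors, with the norms fixed, increases `∫ expSum ^ p`. -/
theorem integral_expSum_rpow_le [Nonempty K] {β p : ℝ} (hβ : 0 ≤ β) (hp : 0 ≤ p) (hp1 : p ≤ 1)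
    (a b : K → E) (hab : ∀ k l, ⟪a k, b l⟫ = 0) (hnorm : ∀ k, ⟪a k, a k⟫ = ⟪b k, b k⟫)
    (hle : ∀ k l, ⟪b k, b l⟫ ≤ ⟪a k, a l⟫) :
    ∫ x, expSum β a x ^ p ∂(stdGaussian E) ≤ ∫ x, expSum β b x ^ p ∂(stdGaussian E) := by
  -- A circular path from `a` to `b`. As the two families are mutually orthogonal, `⟪w θ l, w' θ k⟫`
  -- is `sin θ * cos θ` times the difference of the Gram entries: zero for `l = k` and nonpositive
  -- otherwise, as the integration by parts requires.
  set w : ℝ → K → E := fun θ k => Real.cos θ • a k + Real.sin θ • b k with hw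
  set w' : ℝ → K → E := fun θ k => -Real.sin θ • a k + Real.cos θ • b k with hw'
  set φ : ℝ → ℝ := fun θ => ∫ x, expSum β (w θ) x ^ p ∂(stdGaussian E) with hφ
  set M := ∑ k, (‖a k‖ + ‖b k‖) with hM
  have hMk : ∀ k, ‖a k‖ + ‖b k‖ ≤ M := fun k =>
    Finset.single_le_sum (f := fun k => ‖a k‖ + ‖b k‖) (fun _ _ => by positivity)
      (Finset.mem_univ k)
  have hcomb : ∀ (s t : ℝ) (k : K), |s| ≤ 1 → |t| ≤ 1 → ‖s • a k + t • b k‖ ≤ M := by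
    intro s t k hs ht
    refine (norm_add_le _ _).trans ((add_le_add ?_ ?_).trans (hMk k))
    · rw [norm_smul]; exact mul_le_of_le_one_left (norm_nonneg _) hs
    · rw [norm_smul]; exact mul_le_of_le_one_left (norm_nonneg _) ht
  have hwM : ∀ θ k, ‖w θ k‖ ≤ M := fun θ k =>
    hcomb _ _ k (Real.abs_cos_le_one θ) (Real.abs_sin_le_one θ)
  have hwM' : ∀ θ k, ‖w' θ k‖ ≤ M := fun θ k =>
    hcomb _ _ k (by rw [abs_neg]; exact Real.abs_sin_le_one θ) (Real.abs_cos_le_one θ)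
  have hder : ∀ (x : E) (θ : ℝ), HasDerivAt (fun θ => expSum β (w θ) x ^ p)
      (∑ k, p * β * (⟪w' θ k, x⟫ * softTerm β p (w θ) k x)) θ := by
    intro x θ
    have h1 : ∀ k, HasDerivAt (fun θ => ⟪w θ k, x⟫) ⟪w' θ k, x⟫ θ := by
      intro k
      simp only [hw, hw', inner_add_left, real_inner_smul_left]
      exact ((Real.hasDerivAt_cos θ).mul_const _).add ((Real.hasDerivAt_sin θ).mul_const _)
    have h2 : HasDerivAt (fun θ => expSum β (w θ) x)
        (∑ k, Real.exp (β * ⟪w θ k, x⟫) * (β * ⟪w' θ k, x⟫)) θ := by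
      unfold expSum
      exact HasDerivAt.fun_sum fun k _ => ((h1 k).const_mul β).exp
    have h3 := h2.rpow_const (p := p) (Or.inl (expSum_pos β (w θ) x).ne')
    convert! h3 using 1
    rw [Finset.sum_mul, Finset.sum_mul]
    refine Finset.sum_congr rfl fun k _ => ?_
    unfold softTerm
    ring
  have hφd : ∀ θ, HasDerivAt φ
      (∫ x, ∑ k, p * β * (⟪w' θ k, x⟫ * softTerm β p (w θ) k x) ∂(stdGaussian E)) θ ∧
      ∀ k, Integrable (fun x => ⟪w' θ k, x⟫ * softTerm β p (w θ) k x) (stdGaussian E) := by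
    intro θ
    have hcont : ∀ k, Continuous fun x => ⟪w' θ k, x⟫ * softTerm β p (w θ) k x := fun k =>
      (continuous_const.inner continuous_id).mul (continuous_iff_continuousAt.2 fun x =>
        (hasFDerivAt_softTerm β (w θ) x p k).continuousAt)
    have hbd : ∀ θ k x, ‖⟪w' θ k, x⟫ * softTerm β p (w θ) k x‖ ≤
        M * (‖x‖ * (1 + Fintype.card K * Real.exp (β * M * ‖x‖))) := by
      intro θ k x
      rw [norm_mul, ← mul_assoc]
      refine mul_le_mul ((norm_inner_le_norm _ _).trans
        (mul_le_mul_of_nonneg_right (hwM' θ k) (norm_nonneg _))) ?_ (norm_nonneg _)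
        (mul_nonneg ((norm_nonneg _).trans (hwM' θ k)) (norm_nonneg _))
      rw [Real.norm_eq_abs, abs_of_nonneg (softTerm_nonneg β _ x p k)]
      exact (softTerm_le β _ x p k).trans (expSum_rpow_le _ x hβ hp hp1 (hwM θ))
    have hMint : Integrable (fun x : E =>
        M * (‖x‖ * (1 + Fintype.card K * Real.exp (β * M * ‖x‖)))) (stdGaussian E) :=
      (integrable_norm_mul_exp_growth 1 (Fintype.card K) (β * M)).const_mul M
    refine ⟨(hasDerivAt_integral_of_dominated_loc_of_deriv_le (s := Set.univ) Filter.univ_mem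
      (Filter.Eventually.of_forall fun θ =>
        (continuous_expSum_rpow β (w θ) p).aestronglyMeasurable)
      (integrable_expSum_rpow (w θ) hβ hp hp1)
      (F' := fun θ x => ∑ k, p * β * (⟪w' θ k, x⟫ * softTerm β p (w θ) k x))
      (bound := fun x => ∑ _k : K, p * β *
        (M * (‖x‖ * (1 + Fintype.card K * Real.exp (β * M * ‖x‖)))))
      (continuous_finsetSum _ fun k _ => continuous_const.mul (hcont k)).aestronglyMeasurable
      (Filter.Eventually.of_forall fun x θ _ => ?_)
      (integrable_finsetSum _ fun k _ => hMint.const_mul _)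
      (Filter.Eventually.of_forall fun x θ _ => hder x θ)).2, fun k =>
        hMint.mono' (hcont k).aestronglyMeasurable (Filter.Eventually.of_forall (hbd θ k))⟩
    refine (norm_sum_le _ _).trans (Finset.sum_le_sum fun k _ => ?_)
    rw [norm_mul, Real.norm_eq_abs, abs_of_nonneg (mul_nonneg hp hβ)]
    exact mul_le_mul_of_nonneg_left (hbd θ k x) (mul_nonneg hp hβ)
  have hab' : ∀ k l, ⟪b k, a l⟫ = 0 := fun k l => by rw [real_inner_comm]; exact hab l k
  have hww : ∀ θ k l, ⟪w θ l, w' θ k⟫ = Real.sin θ * Real.cos θ * (⟪b l, b k⟫ - ⟪a l, a k⟫) := by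
    intro θ k l
    simp only [hw, hw', inner_add_left, inner_add_right, real_inner_smul_left,
      real_inner_smul_right, hab, hab']
    ring
  have hmono : MonotoneOn φ (Set.Icc 0 (Real.pi / 2)) := by
    refine monotoneOn_of_deriv_nonneg (convex_Icc _ _)
      (fun θ _ => (hφd θ).1.continuousAt.continuousWithinAt)
      (fun θ _ => (hφd θ).1.differentiableAt.differentiableWithinAt) fun θ hθ => ?_
    rw [interior_Icc] at hθ
    have hs : 0 ≤ Real.sin θ := Real.sin_nonneg_of_nonneg_of_le_pi hθ.1.le (by linarith [hθ.2, Real.pi_pos])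
    have hc : 0 ≤ Real.cos θ := Real.cos_nonneg_of_mem_Icc ⟨by linarith [hθ.1, Real.pi_pos], hθ.2.le⟩
    rw [(hφd θ).1.deriv, integral_finsetSum _ fun k _ => ((hφd θ).2 k).const_mul _]
    refine Finset.sum_nonneg fun k _ => ?_
    rw [integral_const_mul]
    refine mul_nonneg (mul_nonneg hp hβ)
      (integral_inner_mul_softTerm (w θ) hβ hp hp1 k (w' θ k) ?_ fun l => ?_)
    · rw [hww, hnorm k, sub_self, mul_zero]
    · rw [hww]
      exact mul_nonpos_of_nonneg_of_nonpos (mul_nonneg hs hc) (by linarith [hle l k])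
  have h := hmono (Set.left_mem_Icc.2 (by positivity)) (Set.right_mem_Icc.2 (by positivity))
    (by positivity : (0:ℝ) ≤ Real.pi / 2)
  simpa [hφ, hw] using h

end SoftMax

end

/-! ### Comparison of maxima and exponential moments of the Gaussian norm. -/

section

open MeasureTheory ProbabilityTheory Module
open scoped RealInnerProductSpace ENNReal NNReal

section Chevet

/-- With `p = c / β`, the power `expSum ^ p` agrees with the exponential of `c` times the maximum up
to a factor `card K ^ (c / β)`. Slepian's comparison applies for every `β > c`, and the factor tends
to one as `β → ∞`. -/
theorem integral_exp_le_of_inner_le {E : Type*} [NormedAddCommGroup E] [InnerProductSpace ℝ E]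
    [FiniteDimensional ℝ E] [MeasurableSpace E] [BorelSpace E] {K : Type*} [Fintype K] [Nonempty K]
    {c : ℝ} (hc : 0 < c) (a b : K → E) (hab : ∀ k l, ⟪a k, b l⟫ = 0)
    (hnorm : ∀ k, ⟪a k, a k⟫ = ⟪b k, b k⟫) (hle : ∀ k l, ⟪b k, b l⟫ ≤ ⟪a k, a l⟫)
    {f g : E → ℝ} (hf : ∀ x, ∃ k, f x ≤ ⟪a k, x⟫) (hg : ∀ x k, ⟪b k, x⟫ ≤ g x)
    (hgi : Integrable (fun x => Real.exp (c * g x)) (stdGaussian E)) :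
    ∫ x, Real.exp (c * f x) ∂(stdGaussian E) ≤ ∫ x, Real.exp (c * g x) ∂(stdGaussian E) := by
  set m : ℝ := (Fintype.card K : ℝ) with hm
  have hm0 : 0 < m := Nat.cast_pos.2 Fintype.card_pos
  have key : ∀ β > c, ∫ x, Real.exp (c * f x) ∂(stdGaussian E) ≤
      m ^ (c / β) * ∫ x, Real.exp (c * g x) ∂(stdGaussian E) := by
    intro β hβ
    have hβ0 : 0 < β := hc.trans hβ
    have hp : 0 ≤ c / β := (div_pos hc hβ0).le
    have hp1 : c / β ≤ 1 := (div_le_one hβ0).2 hβ.le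
    have hexp : ∀ s, Real.exp (β * s) ^ (c / β) = Real.exp (c * s) := by
      intro s
      rw [← Real.exp_mul]; congr 1; field_simp
    calc ∫ x, Real.exp (c * f x) ∂(stdGaussian E)
        ≤ ∫ x, expSum β a x ^ (c / β) ∂(stdGaussian E) := by
          refine integral_mono_of_nonneg (Filter.Eventually.of_forall fun x => (Real.exp_pos _).le)
            (integrable_expSum_rpow a hβ0.le hp hp1) (Filter.Eventually.of_forall fun x => ?_)
          obtain ⟨k, hk⟩ := hf x
          dsimp only
          rw [← hexp]
          refine Real.rpow_le_rpow (Real.exp_pos _).le (le_trans ?_ (exp_le_expSum β a x k)) hp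
          exact Real.exp_le_exp.2 (mul_le_mul_of_nonneg_left hk hβ0.le)
      _ ≤ ∫ x, expSum β b x ^ (c / β) ∂(stdGaussian E) :=
          integral_expSum_rpow_le hβ0.le hp hp1 a b hab hnorm hle
      _ ≤ ∫ x, m ^ (c / β) * Real.exp (c * g x) ∂(stdGaussian E) := by
          refine integral_mono (integrable_expSum_rpow b hβ0.le hp hp1) (hgi.const_mul _)
            fun x => ?_
          dsimp only
          rw [← hexp, ← Real.mul_rpow hm0.le (Real.exp_pos _).le]
          refine Real.rpow_le_rpow (expSum_nonneg _ _ _) ?_ hp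
          have : expSum β b x ≤ ∑ _k : K, Real.exp (β * g x) :=
            Finset.sum_le_sum fun k _ =>
              Real.exp_le_exp.2 (mul_le_mul_of_nonneg_left (hg x k) hβ0.le)
          simpa using this
      _ = _ := integral_const_mul _ _
  have hlim : Filter.Tendsto (fun β : ℝ => m ^ (c / β) * ∫ x, Real.exp (c * g x) ∂(stdGaussian E))
      Filter.atTop (nhds (m ^ (0:ℝ) * ∫ x, Real.exp (c * g x) ∂(stdGaussian E))) := by
    refine Filter.Tendsto.mul_const _ ?_
    exact ((Real.continuous_const_rpow hm0.ne').tendsto 0).comp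
      (tendsto_const_nhds.div_atTop Filter.tendsto_id)
  rw [Real.rpow_zero, one_mul] at hlim
  exact ge_of_tendsto hlim (Filter.eventually_gt_atTop c |>.mono key)

/-- The law of a family of independent standard normal variables. -/
noncomputable abbrev gaussianPi (ι : Type*) [Fintype ι] : Measure (ι → ℝ) :=
  Measure.pi fun _ => gaussianReal 0 1

theorem measurePreserving_toLp_gaussianPi (ι : Type*) [Fintype ι] :
    MeasurePreserving (WithLp.toLp 2) (gaussianPi ι) (stdGaussian (EuclideanSpace ℝ ι)) :=
  ⟨by fun_prop, map_pi_eq_stdGaussian⟩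

theorem integral_gaussianPi_toLp {ι : Type*} [Fintype ι] (f : EuclideanSpace ℝ ι → ℝ) :
    ∫ x, f (WithLp.toLp 2 x) ∂(gaussianPi ι) = ∫ x, f x ∂(stdGaussian (EuclideanSpace ℝ ι)) :=
  (measurePreserving_toLp_gaussianPi ι).integral_comp
    (MeasurableEquiv.toLp 2 (ι → ℝ)).measurableEmbedding f

theorem integral_gaussianPi_sum {α β : Type*} [Fintype α] [Fintype β] (f : (α → ℝ) → ℝ)
    (g : (β → ℝ) → ℝ) :
    ∫ x : α ⊕ β → ℝ, f (fun i => x (Sum.inl i)) * g (fun i => x (Sum.inr i)) ∂(gaussianPi (α ⊕ β))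
      = (∫ x, f x ∂(gaussianPi α)) * ∫ x, g x ∂(gaussianPi β) := by
  rw [← integral_prod_mul]
  exact (measurePreserving_sumPiEquivProdPi (fun _ : α ⊕ β => gaussianReal 0 1)).integral_comp'
    (fun z : (α → ℝ) × (β → ℝ) => f z.1 * g z.2)

theorem integral_exp_mul_sq_gaussianReal {s : ℝ} (hs : s < 1) :
    ∫ x, Real.exp (s / 2 * x ^ 2) ∂(gaussianReal 0 1) = (√(1 - s))⁻¹ := by
  rw [integral_gaussianReal_eq_integral_smul one_ne_zero]
  have h : ∀ x : ℝ, gaussianPDFReal 0 1 x • Real.exp (s / 2 * x ^ 2) =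
      (√(2 * Real.pi))⁻¹ * Real.exp (-((1 - s) / 2) * x ^ 2) := by
    intro x
    rw [gaussianPDFReal_def, smul_eq_mul, mul_assoc, ← Real.exp_add]
    simp only [NNReal.coe_one, mul_one, sub_zero]
    ring_nf
  simp_rw [h]
  rw [integral_const_mul, integral_gaussian, ← Real.sqrt_inv, ← Real.sqrt_inv,
    ← Real.sqrt_mul (by positivity)]
  congr 1
  have : 1 - s ≠ 0 := by linarith
  field_simp

theorem integrable_exp_mul_sq_gaussianReal {s : ℝ} (hs : s < 1) :
    Integrable (fun x : ℝ => Real.exp (s / 2 * x ^ 2)) (gaussianReal 0 1) := by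
  refine Integrable.of_integral_ne_zero ?_
  rw [integral_exp_mul_sq_gaussianReal hs]
  have : 0 < √(1 - s) := Real.sqrt_pos.2 (by linarith)
  positivity

/-- From `log α ≤ sinh (log α)`; what is then left over is `(α - 1) * (1 - α⁻¹ ^ 2) / 2 ≥ 0`. It
closes the moment bound below with no loss in the constants `√N` and `1 / 2`. -/
theorem log_le_of_one_le {α : ℝ} (hα : 1 ≤ α) :
    Real.log α ≤ α - α⁻¹ + (α⁻¹ ^ 2 - 1) / 2 := by
  have h0 : 0 < α := by linarith
  have h1 : Real.log α ≤ (α - α⁻¹) / 2 := by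
    rw [← Real.sinh_log h0]; exact Real.self_le_sinh_iff.2 (Real.log_nonneg hα)
  have h2 : α⁻¹ ≤ 1 := inv_le_one_of_one_le₀ hα
  have h3 : α * α⁻¹ = 1 := mul_inv_cancel₀ h0.ne'
  have h4 : 0 ≤ (α - 1) * (1 - α⁻¹ ^ 2) := mul_nonneg (by linarith) (by nlinarith [inv_pos.2 h0])
  have h5 : (α - 1) * (1 - α⁻¹ ^ 2) = α - α⁻¹ - 1 + α⁻¹ ^ 2 := by
    have : α * α⁻¹ ^ 2 = α⁻¹ := by rw [pow_two, ← mul_assoc, h3, one_mul]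
    linear_combination -this
  linarith

theorem integrable_exp_mul_norm_gaussianPi {ι : Type*} [Fintype ι] (c : ℝ) :
    Integrable (fun x => Real.exp (c * ‖(WithLp.toLp 2 x : EuclideanSpace ℝ ι)‖)) (gaussianPi ι) :=
  (measurePreserving_toLp_gaussianPi ι).integrable_comp_of_integrable
    (integrable_exp_mul_norm_stdGaussian c)

/-- A sharp bound for the exponential moments of the norm of a standard Gaussian vector. -/
theorem integral_exp_mul_norm_gaussianPi_le {ι : Type*} [Fintype ι] [Nonempty ι] {c : ℝ}
    (hc : 0 < c) :
    ∫ x, Real.exp (c * ‖(WithLp.toLp 2 x : EuclideanSpace ℝ ι)‖) ∂(gaussianPi ι) ≤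
      Real.exp (c * √(Fintype.card ι) + c ^ 2 / 2) := by
  set N : ℝ := (Fintype.card ι : ℝ) with hN
  have hN0 : 0 < N := Nat.cast_pos.2 Fintype.card_pos
  set r := √N with hr
  have hr0 : 0 < r := Real.sqrt_pos.2 hN0
  have hrr : r ^ 2 = N := Real.sq_sqrt hN0.le
  -- The norm is linearized by `c * y ≤ c * ρ / 2 + c * y ^ 2 / (2 * ρ)`. The best `ρ` is `r * α`
  -- with this `α`: then `c / ρ = 1 - α⁻¹ ^ 2`, and each coordinate contributes exactly the factor
  -- `α`.
  obtain ⟨α, hα1, hαc⟩ : ∃ α : ℝ, 1 ≤ α ∧ α - α⁻¹ = c / r := by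
    refine ⟨Real.exp (Real.arsinh (c / r / 2)), Real.one_le_exp
      (Real.arsinh_nonneg_iff.2 (by positivity)), ?_⟩
    rw [← Real.exp_neg]
    have := Real.sinh_eq (Real.arsinh (c / r / 2))
    rw [Real.sinh_arsinh] at this
    linarith
  have hα0 : 0 < α := by linarith
  have hcα : c = r * (α - α⁻¹) := by rw [hαc]; field_simp
  set s : ℝ := 1 - α⁻¹ ^ 2 with hs
  have hs1 : s < 1 := by rw [hs]; linarith [pow_pos (inv_pos.2 hα0) 2]
  have hsa : s = c / (r * α) := by rw [hs, hcα]; field_simp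
  have hpt : ∀ x : ι → ℝ, Real.exp (c * ‖(WithLp.toLp 2 x : EuclideanSpace ℝ ι)‖) ≤
      Real.exp (c * (r * α) / 2) * ∏ i, Real.exp (s / 2 * x i ^ 2) := by
    intro x
    rw [← Real.exp_sum, ← Real.exp_add, Real.exp_le_exp, ← Finset.mul_sum]
    have : ∑ i, x i ^ 2 = ‖(WithLp.toLp 2 x : EuclideanSpace ℝ ι)‖ ^ 2 := by
      rw [EuclideanSpace.real_norm_sq_eq]
    rw [this, hsa]
    set y := ‖(WithLp.toLp 2 x : EuclideanSpace ℝ ι)‖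
    have : c * (r * α) / 2 + c / (r * α) / 2 * y ^ 2 - c * y
        = c / (r * α) / 2 * (y - r * α) ^ 2 := by field_simp; ring
    have h2 : 0 ≤ c / (r * α) / 2 * (y - r * α) ^ 2 := by positivity
    linarith
  have hint : Integrable (fun x : ι → ℝ => ∏ i, Real.exp (s / 2 * x i ^ 2)) (gaussianPi ι) :=
    Integrable.fintype_prod (f := fun _ y => Real.exp (s / 2 * y ^ 2))
      fun _ => integrable_exp_mul_sq_gaussianReal hs1
  calc ∫ x, Real.exp (c * ‖(WithLp.toLp 2 x : EuclideanSpace ℝ ι)‖) ∂(gaussianPi ι)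
      ≤ ∫ x : ι → ℝ, Real.exp (c * (r * α) / 2) * ∏ i, Real.exp (s / 2 * x i ^ 2)
          ∂(gaussianPi ι) := by
        exact integral_mono (integrable_exp_mul_norm_gaussianPi c) (hint.const_mul _) hpt
    _ = Real.exp (c * (r * α) / 2) * α ^ Fintype.card ι := by
        rw [integral_const_mul, integral_fintype_prod_eq_pow (fun y => Real.exp (s / 2 * y ^ 2)),
          integral_exp_mul_sq_gaussianReal hs1]
        congr 2
        rw [hs, sub_sub_cancel, Real.sqrt_sq (inv_pos.2 hα0).le, inv_inv]
    _ = Real.exp (c * (r * α) / 2 + N * Real.log α) := by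
        rw [Real.exp_add, ← Real.exp_log (pow_pos hα0 (Fintype.card ι)), Real.log_pow]
    _ ≤ _ := by
        rw [Real.exp_le_exp]
        have h1 := mul_le_mul_of_nonneg_left (log_le_of_one_le hα1) hN0.le
        have h3 : α * α⁻¹ = 1 := mul_inv_cancel₀ hα0.ne'
        have h4 : c * (r * α) / 2 = N * (α ^ 2 - 1) / 2 := by
          rw [hcα, ← hrr]; linear_combination (-(r ^ 2) / 2) * h3
        have h5 : c * r + c ^ 2 / 2 = N * (α - α⁻¹) + N * (α ^ 2 + α⁻¹ ^ 2 - 2) / 2 := by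
          rw [hcα, ← hrr]; linear_combination (-(r ^ 2)) * h3
        rw [h4, h5]
        linarith

end Chevet

end

/-! ### Chevet's inequality and the norm of a Gaussian matrix. -/

section

open MeasureTheory ProbabilityTheory Module
open scoped RealInnerProductSpace ENNReal NNReal

section ChevetMatrix

variable {ι κ : Type*} [Fintype ι] [Fintype κ]

/-- The rank one matrix with entries `u i * v j`, as a vector. -/
noncomputable def outer (u : EuclideanSpace ℝ ι) (v : EuclideanSpace ℝ κ) :
    EuclideanSpace ℝ (ι × κ) :=
  WithLp.toLp 2 fun ij => u ij.1 * v ij.2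

theorem inner_outer_outer (u u' : EuclideanSpace ℝ ι) (v v' : EuclideanSpace ℝ κ) :
    ⟪outer u v, outer u' v'⟫ = ⟪u, u'⟫ * ⟪v, v'⟫ := by
  simp only [outer, PiLp.inner_apply, Fintype.sum_prod_type, Finset.sum_mul_sum]
  refine Finset.sum_congr rfl fun i _ => Finset.sum_congr rfl fun j _ => ?_
  simp only [RCLike.inner_apply, conj_trivial]
  ring

/-- **Chevet's inequality** for exponential moments of a Gaussian matrix. -/
theorem integral_exp_bilinear_le [Nonempty ι] [Nonempty κ] {K : Type*} [Fintype K] [Nonempty K]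
    {c : ℝ} (hc : 0 < c)
    (u : K → EuclideanSpace ℝ ι) (v : K → EuclideanSpace ℝ κ) (hu : ∀ k, ‖u k‖ = 1)
    (hv : ∀ k, ‖v k‖ = 1) {F : (ι × κ → ℝ) → ℝ}
    (hF : ∀ G, ∃ k, F G ≤ ⟪outer (u k) (v k), WithLp.toLp 2 G⟫) :
    ∫ G, Real.exp (c * F G) ∂(gaussianPi (ι × κ)) ≤
      Real.exp (c * (√(Fintype.card ι) + √(Fintype.card κ)) + c ^ 2 / 2) := by
  -- One space carries the matrix, an auxiliary scalar and the two comparison vectors. The scalar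
  -- equalizes the norms: the Gram entries become `⟪u, u'⟫ * ⟪v, v'⟫ + 1` and `⟪u, u'⟫ + ⟪v, v'⟫`,
  -- and they differ by `(1 - ⟪u, u'⟫) * (1 - ⟪v, v'⟫) ≥ 0`.
  let J := ((ι × κ) ⊕ Unit) ⊕ (ι ⊕ κ)
  set a : K → EuclideanSpace ℝ J := fun k =>
    WithLp.toLp 2 (Sum.elim (Sum.elim (outer (u k) (v k)) fun _ => 1) fun _ => 0) with ha
  set b : K → EuclideanSpace ℝ J := fun k =>
    WithLp.toLp 2 (Sum.elim (fun _ => 0) (Sum.elim (u k) (v k))) with hb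
  have haa : ∀ k l, ⟪a k, a l⟫ = ⟪u k, u l⟫ * ⟪v k, v l⟫ + 1 := by
    intro k l
    rw [← inner_outer_outer]
    simp [ha, J, PiLp.inner_apply, Fintype.sum_sum_type]
  have hbb : ∀ k l, ⟪b k, b l⟫ = ⟪u k, u l⟫ + ⟪v k, v l⟫ := by
    intro k l
    simp [hb, J, PiLp.inner_apply, Fintype.sum_sum_type]
  have hab : ∀ k l, ⟪a k, b l⟫ = 0 := by
    intro k l
    simp [ha, hb, J, PiLp.inner_apply, Fintype.sum_sum_type]
  have huu : ∀ k l, ⟪u k, u l⟫ ≤ 1 := by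
    intro k l
    have := real_inner_le_norm (u k) (u l)
    rwa [hu, hu, one_mul] at this
  have hvv : ∀ k l, ⟪v k, v l⟫ ≤ 1 := by
    intro k l
    have := real_inner_le_norm (v k) (v l)
    rwa [hv, hv, one_mul] at this
  set f : EuclideanSpace ℝ J → ℝ := fun x =>
    F (fun ij => x (Sum.inl (Sum.inl ij))) + x (Sum.inl (Sum.inr ())) with hf
  set g : EuclideanSpace ℝ J → ℝ := fun x =>
    ‖(WithLp.toLp 2 (fun i => x (Sum.inr (Sum.inl i))) : EuclideanSpace ℝ ι)‖ +
      ‖(WithLp.toLp 2 (fun j => x (Sum.inr (Sum.inr j))) : EuclideanSpace ℝ κ)‖ with hg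
  have hgcont : Continuous g := by fun_prop
  have hgle : ∀ x, g x ≤ 2 * ‖x‖ := by
    intro x
    have h1 : ‖(WithLp.toLp 2 (fun i => x (Sum.inr (Sum.inl i))) : EuclideanSpace ℝ ι)‖ ≤ ‖x‖ := by
      rw [EuclideanSpace.norm_eq, EuclideanSpace.norm_eq x]
      refine Real.sqrt_le_sqrt ?_
      simp only [J, Fintype.sum_sum_type]
      have := Finset.sum_nonneg fun (i : ι × κ) (_ : i ∈ Finset.univ) =>
        sq_nonneg ‖x (Sum.inl (Sum.inl i))‖
      have := Finset.sum_nonneg fun (i : Unit) (_ : i ∈ Finset.univ) =>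
        sq_nonneg ‖x (Sum.inl (Sum.inr i))‖
      have := Finset.sum_nonneg fun (i : κ) (_ : i ∈ Finset.univ) =>
        sq_nonneg ‖x (Sum.inr (Sum.inr i))‖
      linarith
    have h2 : ‖(WithLp.toLp 2 (fun i => x (Sum.inr (Sum.inr i))) : EuclideanSpace ℝ κ)‖ ≤ ‖x‖ := by
      rw [EuclideanSpace.norm_eq, EuclideanSpace.norm_eq x]
      refine Real.sqrt_le_sqrt ?_
      simp only [J, Fintype.sum_sum_type]
      have := Finset.sum_nonneg fun (i : ι × κ) (_ : i ∈ Finset.univ) =>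
        sq_nonneg ‖x (Sum.inl (Sum.inl i))‖
      have := Finset.sum_nonneg fun (i : Unit) (_ : i ∈ Finset.univ) =>
        sq_nonneg ‖x (Sum.inl (Sum.inr i))‖
      have := Finset.sum_nonneg fun (i : ι) (_ : i ∈ Finset.univ) =>
        sq_nonneg ‖x (Sum.inr (Sum.inl i))‖
      linarith
    simp only [hg]; linarith
  have key := integral_exp_le_of_inner_le hc a b hab
    (fun k => by
      rw [haa, hbb]; simp only [real_inner_self_eq_norm_sq, hu, hv]; norm_num)
    (fun k l => by
      rw [haa, hbb]
      nlinarith [huu k l, hvv k l])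
    (f := f) (g := g)
    (fun x => by
      obtain ⟨k, hk⟩ := hF (fun ij => x (Sum.inl (Sum.inl ij)))
      refine ⟨k, ?_⟩
      have : ⟪a k, x⟫ = ⟪outer (u k) (v k),
          (WithLp.toLp 2 (fun ij => x (Sum.inl (Sum.inl ij))) : EuclideanSpace ℝ (ι × κ))⟫ +
          x (Sum.inl (Sum.inr ())) := by
        simp [ha, J, PiLp.inner_apply, Fintype.sum_sum_type]
      rw [this]
      simp only [hf]
      linarith)
    (fun x k => by
      have : ⟪b k, x⟫ = ⟪u k, (WithLp.toLp 2 (fun i => x (Sum.inr (Sum.inl i))) :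
          EuclideanSpace ℝ ι)⟫ + ⟪v k, (WithLp.toLp 2 (fun j => x (Sum.inr (Sum.inr j))) :
          EuclideanSpace ℝ κ)⟫ := by
        simp [hb, J, PiLp.inner_apply, Fintype.sum_sum_type]
      rw [this]
      simp only [hg]
      have h1 := real_inner_le_norm (u k) (WithLp.toLp 2 (fun i => x (Sum.inr (Sum.inl i))))
      have h2 := real_inner_le_norm (v k) (WithLp.toLp 2 (fun i => x (Sum.inr (Sum.inr i))))
      rw [hu, one_mul] at h1
      rw [hv, one_mul] at h2
      linarith)
    ((integrable_exp_mul_norm_stdGaussian (c * 2)).mono' (by fun_prop)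
      (Filter.Eventually.of_forall fun x => by
        rw [Real.norm_eq_abs, abs_of_pos (Real.exp_pos _), Real.exp_le_exp, mul_assoc]
        exact mul_le_mul_of_nonneg_left (hgle x) hc.le))
  rw [← integral_gaussianPi_toLp, ← integral_gaussianPi_toLp] at key
  have hleft : ∫ x : J → ℝ, Real.exp (c * f (WithLp.toLp 2 x)) ∂(gaussianPi J) =
      (∫ G, Real.exp (c * F G) ∂(gaussianPi (ι × κ))) * Real.exp (c ^ 2 / 2) := by
    have h1 := integral_gaussianPi_sum (α := (ι × κ) ⊕ Unit) (β := ι ⊕ κ)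
      (fun x => Real.exp (c * F fun ij => x (Sum.inl ij)) *
        Real.exp (c * x (Sum.inr ()))) (fun _ => 1)
    have h2 := integral_gaussianPi_sum (α := ι × κ) (β := Unit)
      (fun G => Real.exp (c * F G)) (fun y => Real.exp (c * y ()))
    have h3 : ∫ y : Unit → ℝ, Real.exp (c * y ()) ∂(gaussianPi Unit) = Real.exp (c ^ 2 / 2) := by
      have h4 := integral_fintype_prod_eq_pow (ι := Unit) (μ := gaussianReal 0 1)
        (fun y : ℝ => Real.exp (c * y))
      simp only [Finset.univ_unique, Finset.prod_singleton, Fintype.card_unit, pow_one] at h4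
      have h5 := congrFun (mgf_fun_id_gaussianReal (μ := 0) (v := 1)) c
      simp only [mgf, zero_mul, zero_add, NNReal.coe_one, one_mul] at h5
      rw [← h5, ← h4]
    simp only [mul_one, integral_const, probReal_univ, smul_eq_mul] at h1
    rw [h2, h3] at h1
    rw [← h1]
    refine integral_congr_ae (Filter.Eventually.of_forall fun x => ?_)
    simp only [hf]
    rw [← Real.exp_add, mul_add]
  have hright : ∫ x : J → ℝ, Real.exp (c * g (WithLp.toLp 2 x)) ∂(gaussianPi J) =
      (∫ x, Real.exp (c * ‖(WithLp.toLp 2 x : EuclideanSpace ℝ ι)‖) ∂(gaussianPi ι)) *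
        ∫ x, Real.exp (c * ‖(WithLp.toLp 2 x : EuclideanSpace ℝ κ)‖) ∂(gaussianPi κ) := by
    have h1 := integral_gaussianPi_sum (α := (ι × κ) ⊕ Unit) (β := ι ⊕ κ) (fun _ => 1)
      (fun x => Real.exp (c * ‖(WithLp.toLp 2 (fun i => x (Sum.inl i)) : EuclideanSpace ℝ ι)‖) *
        Real.exp (c * ‖(WithLp.toLp 2 (fun i => x (Sum.inr i)) : EuclideanSpace ℝ κ)‖))
    have h2 := integral_gaussianPi_sum (α := ι) (β := κ)
      (fun x => Real.exp (c * ‖(WithLp.toLp 2 x : EuclideanSpace ℝ ι)‖))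
      (fun x => Real.exp (c * ‖(WithLp.toLp 2 x : EuclideanSpace ℝ κ)‖))
    simp only [one_mul, integral_const, probReal_univ, smul_eq_mul] at h1
    rw [h2] at h1
    rw [← h1]
    refine integral_congr_ae (Filter.Eventually.of_forall fun x => ?_)
    simp only [hg]
    rw [← Real.exp_add, mul_add]
  -- The two norms on the right each cost `c ^ 2 / 2`; the auxiliary scalar on the left cancels one
  -- of them.
  rw [hleft, hright] at key
  have h1 := integral_exp_mul_norm_gaussianPi_le (ι := ι) hc
  have h2 := integral_exp_mul_norm_gaussianPi_le (ι := κ) hc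
  have h3 := key.trans (mul_le_mul h1 h2 (integral_nonneg fun _ => (Real.exp_pos _).le)
    (Real.exp_pos _).le)
  rw [← le_div_iff₀ (Real.exp_pos _), ← Real.exp_add, ← Real.exp_sub] at h3
  refine h3.trans (Real.exp_le_exp.2 (le_of_eq ?_))
  ring

/-- Markov's inequality for the exponential of `t` times the maximum. Taking the moment parameter
equal to the deviation `t` leaves the exponent `t ^ 2 / 2 - t ^ 2`. -/
theorem gaussianPi_exists_bilinear_gt_le [Nonempty ι] [Nonempty κ] {K : Type*} [Fintype K]
    (u : K → EuclideanSpace ℝ ι) (v : K → EuclideanSpace ℝ κ) (hu : ∀ k, ‖u k‖ = 1)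
    (hv : ∀ k, ‖v k‖ = 1) {t : ℝ} (ht : 0 < t) :
    (gaussianPi (ι × κ)).real {G | ∃ k, √(Fintype.card ι) + √(Fintype.card κ) + t <
      ⟪outer (u k) (v k), WithLp.toLp 2 G⟫} ≤ Real.exp (-(t ^ 2 / 2)) := by
  rcases isEmpty_or_nonempty K with hK | hK
  · simp [Real.exp_nonneg]
  set s := √(Fintype.card ι) + √(Fintype.card κ) + t with hs
  set X : K → (ι × κ → ℝ) → ℝ := fun k G => ⟪outer (u k) (v k), WithLp.toLp 2 G⟫ with hX
  set F : (ι × κ → ℝ) → ℝ := fun G => Finset.univ.sup' Finset.univ_nonempty fun k => X k G with hF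
  have hXF : ∀ G k, X k G ≤ F G := fun G k =>
    Finset.le_sup' (fun k => X k G) (Finset.mem_univ k)
  have hFX : ∀ G, ∃ k, F G ≤ X k G := fun G => by
    obtain ⟨k, _, hk⟩ := Finset.exists_mem_eq_sup' Finset.univ_nonempty fun k => X k G
    exact ⟨k, hk.le⟩
  have houter : ∀ k, ‖outer (u k) (v k)‖ = 1 := by
    intro k
    have := inner_outer_outer (u k) (u k) (v k) (v k)
    simp only [real_inner_self_eq_norm_sq, hu, hv, one_pow, mul_one] at this
    nlinarith [norm_nonneg (outer (u k) (v k))]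
  have hXn : ∀ k G, X k G ≤ ‖(WithLp.toLp 2 G : EuclideanSpace ℝ (ι × κ))‖ := by
    intro k G
    have := real_inner_le_norm (outer (u k) (v k)) (WithLp.toLp 2 G)
    rwa [houter, one_mul] at this
  have hFcont : Continuous F := by
    refine Continuous.finset_sup'_apply _ fun k _ => ?_
    exact continuous_const.inner (PiLp.continuous_toLp 2 _)
  have hint : Integrable (fun G => Real.exp (t * F G)) (gaussianPi (ι × κ)) := by
    refine (integrable_exp_mul_norm_gaussianPi t).mono'
      (Real.continuous_exp.comp (continuous_const.mul hFcont)).aestronglyMeasurable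
      (Filter.Eventually.of_forall fun G => ?_)
    rw [Real.norm_eq_abs, abs_of_pos (Real.exp_pos _), Real.exp_le_exp]
    obtain ⟨k, hk⟩ := hFX G
    exact mul_le_mul_of_nonneg_left (hk.trans (hXn k G)) ht.le
  have hmarkov := mul_meas_ge_le_integral_of_nonneg
    (Filter.Eventually.of_forall fun G => (Real.exp_pos (t * F G)).le) hint (Real.exp (t * s))
  have hle := hmarkov.trans (integral_exp_bilinear_le ht u v hu hv hFX)
  rw [← le_div_iff₀' (Real.exp_pos _), ← Real.exp_sub] at hle
  refine le_trans (measureReal_mono ?_) (hle.trans (Real.exp_le_exp.2 (le_of_eq ?_)))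
  · rintro G ⟨k, hk⟩
    exact Real.exp_le_exp.2 (mul_le_mul_of_nonneg_left (hk.le.trans (hXF G k)) ht.le)
  · rw [hs]; ring

theorem inner_outer_eq [DecidableEq κ] (u : EuclideanSpace ℝ ι) (v : EuclideanSpace ℝ κ)
    (G : ι × κ → ℝ) :
    ⟪outer u v, WithLp.toLp 2 G⟫ =
      ⟪u, Matrix.toEuclideanLin (Matrix.of fun i j => G (i, j)) v⟫ := by
  simp only [outer, PiLp.inner_apply, Fintype.sum_prod_type, RCLike.inner_apply, conj_trivial,
    Matrix.toLpLin_apply, Matrix.mulVec, dotProduct, Matrix.of_apply, Finset.sum_mul]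
  refine Finset.sum_congr rfl fun i _ => Finset.sum_congr rfl fun j _ => ?_
  ring

/-- The deviation inequality of Davidson and Szarek for the operator norm of a Gaussian matrix. -/
theorem gaussianPi_opNorm_gt_le [Nonempty ι] [Nonempty κ] [DecidableEq κ] {t : ℝ} (ht : 0 < t) :
    (gaussianPi (ι × κ)).real {G | ∃ v : EuclideanSpace ℝ κ,
      (√(Fintype.card ι) + √(Fintype.card κ) + t) * ‖v‖ <
        ‖Matrix.toEuclideanLin (Matrix.of fun i j => G (i, j)) v‖} ≤ Real.exp (-(t ^ 2 / 2)) := by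
  set s := √(Fintype.card ι) + √(Fintype.card κ) + t with hs
  have hs0 : 0 < s := by positivity
  let S := Metric.sphere (0 : EuclideanSpace ℝ ι) 1 × Metric.sphere (0 : EuclideanSpace ℝ κ) 1
  have hne : Nonempty S := by
    classical
    obtain ⟨i⟩ := ‹Nonempty ι›
    obtain ⟨j⟩ := ‹Nonempty κ›
    exact ⟨⟨EuclideanSpace.single i 1, by simp⟩, ⟨EuclideanSpace.single j 1, by simp⟩⟩
  -- The finite bound does not depend on the number of pairs, so it passes to an increasing union
  -- over a dense sequence. The excess is a strict inequality, hence an open condition on the pair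
  -- of unit vectors, and some pair of the sequence meets it.
  let D : ℕ → S := TopologicalSpace.denseSeq S
  let A : ℕ → Set (ι × κ → ℝ) := fun m => {G | ∃ k : Fin m, s <
    ⟪outer (D k).1.1 (D k).2.1, WithLp.toLp 2 G⟫}
  have hA : ∀ m, gaussianPi (ι × κ) (A m) ≤ ENNReal.ofReal (Real.exp (-(t ^ 2 / 2))) := by
    intro m
    rw [← ofReal_measureReal]
    exact ENNReal.ofReal_le_ofReal (gaussianPi_exists_bilinear_gt_le
      (fun k : Fin m => (D k).1.1) (fun k => (D k).2.1) (fun k => by simp)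
      (fun k => by simp) ht)
  have hmono : Monotone A := by
    rintro m m' hm G ⟨k, hk⟩
    exact ⟨Fin.castLE hm k, hk⟩
  have hsub : {G : ι × κ → ℝ | ∃ v : EuclideanSpace ℝ κ,
      s * ‖v‖ < ‖Matrix.toEuclideanLin (Matrix.of fun i j => G (i, j)) v‖} ⊆ ⋃ m, A m := by
    rintro G ⟨v, hv⟩
    set L := Matrix.toEuclideanLin (Matrix.of fun i j => G (i, j)) with hL
    have hv0 : v ≠ 0 := by
      rintro rfl
      simp at hv
    have hvn : 0 < ‖v‖ := norm_pos_iff.2 hv0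
    have hLn : 0 < ‖L v‖ := lt_of_le_of_lt (by positivity) hv
    have hopen : IsOpen {z : S | s < ⟪z.1.1, L z.2.1⟫} := by
      refine isOpen_lt continuous_const ?_
      have : Continuous L := L.continuous_of_finiteDimensional
      exact (continuous_subtype_val.comp continuous_fst).inner
        (this.comp (continuous_subtype_val.comp continuous_snd))
    have hnon : ({z : S | s < ⟪z.1.1, L z.2.1⟫}).Nonempty := by
      refine ⟨⟨⟨‖L v‖⁻¹ • L v, by simp [norm_smul, hLn.ne']⟩,
        ⟨‖v‖⁻¹ • v, by simp [norm_smul, hvn.ne']⟩⟩, ?_⟩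
      simp only [Set.mem_ofPred_eq, map_smul, real_inner_smul_left, real_inner_smul_right,
        real_inner_self_eq_norm_sq]
      rw [show ‖v‖⁻¹ * (‖L v‖⁻¹ * ‖L v‖ ^ 2) = ‖L v‖ / ‖v‖ by field_simp]
      exact (lt_div_iff₀ hvn).2 hv
    obtain ⟨k, hk⟩ := (TopologicalSpace.denseRange_denseSeq S).exists_mem_open hopen hnon
    refine Set.mem_iUnion.2 ⟨k + 1, ⟨k, Nat.lt_succ_self k⟩, ?_⟩
    rw [inner_outer_eq]
    exact hk
  refine ENNReal.toReal_le_of_le_ofReal (Real.exp_pos _).le ((measure_mono hsub).trans ?_)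
  rw [hmono.measure_iUnion]
  exact iSup_le hA

end ChevetMatrix

end

/-! ### Singular values: Weyl's inequality and vanishing beyond the rank. -/

section

open Module
open scoped RealInnerProductSpace

section SingularValues

variable {E F : Type*} [NormedAddCommGroup E] [InnerProductSpace ℝ E] [FiniteDimensional ℝ E]
  [NormedAddCommGroup F] [InnerProductSpace ℝ F] [FiniteDimensional ℝ F]

theorem norm_sq_eq_sum_singularValues (A : E →ₗ[ℝ] F) {n : ℕ} (hn : finrank ℝ E = n) (x : E) :
    ‖A x‖ ^ 2 = ∑ i : Fin n, A.singularValues i ^ 2 *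
      ⟪A.isSymmetric_adjoint_comp_self.eigenvectorBasis hn i, x⟫ ^ 2 := by
  set hS := A.isSymmetric_adjoint_comp_self
  set b := hS.eigenvectorBasis hn
  have h1 : ‖A x‖ ^ 2 = ⟪(A.adjoint ∘ₗ A) x, x⟫ := by
    rw [LinearMap.comp_apply, LinearMap.adjoint_inner_left, real_inner_self_eq_norm_sq]
  rw [h1, ← b.sum_inner_mul_inner]
  refine Finset.sum_congr rfl fun i _ => ?_
  have h2 : ⟪(A.adjoint ∘ₗ A) x, b i⟫ = A.singularValues i ^ 2 * ⟪b i, x⟫ := by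
    rw [hS x (b i), hS.apply_eigenvectorBasis hn i, real_inner_smul_right, real_inner_comm,
      A.sq_singularValues_fin hn]
    rfl
  rw [h2]; ring

theorem sum_sq_inner_eigenvectorBasis (A : E →ₗ[ℝ] F) {n : ℕ} (hn : finrank ℝ E = n) (x : E) :
    ‖x‖ ^ 2 = ∑ i : Fin n, ⟪A.isSymmetric_adjoint_comp_self.eigenvectorBasis hn i, x⟫ ^ 2 :=
  (OrthonormalBasis.sum_sq_inner_right _ x).symm

/-- **Weyl's inequality**: singular values are Lipschitz for the operator norm. -/
theorem singularValues_le_add (A B : E →ₗ[ℝ] F) {s : ℝ} (hs : 0 ≤ s)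
    (h : ∀ x, ‖A x - B x‖ ≤ s * ‖x‖) (k : ℕ) :
    A.singularValues k ≤ B.singularValues k + s := by
  by_cases! hk : finrank ℝ E ≤ k
  · rw [A.singularValues_of_finrank_le hk, B.singularValues_of_finrank_le hk]
    linarith
  obtain ⟨n, hn⟩ : ∃ n, finrank ℝ E = n := ⟨_, rfl⟩
  rw [hn] at hk
  set a := A.isSymmetric_adjoint_comp_self.eigenvectorBasis hn
  set b := B.isSymmetric_adjoint_comp_self.eigenvectorBasis hn
  -- Orthogonality to the `a i` with `i > k` and to the `b i` with `i < k` gives `n - 1` linear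
  -- conditions, so a nonzero `x` meets them all. On it `A` stretches by at least its `k`-th
  -- singular value and `B` by at most its own.
  let φ : E →ₗ[ℝ] ({i : Fin n // i ≠ ⟨k, hk⟩} → ℝ) :=
    LinearMap.pi fun i => if k < (i : Fin n) then innerₗ E (a i) else innerₗ E (b i)
  have hφ : LinearMap.ker φ ≠ ⊥ := by
    refine LinearMap.ker_ne_bot_of_finrank_lt ?_
    rw [finrank_fintype_fun_eq_card, Fintype.card_subtype_compl, Fintype.card_fin,
      Fintype.card_subtype_eq, hn]
    omega
  obtain ⟨x, hxφ, hx0⟩ := Submodule.exists_mem_ne_zero_of_ne_bot hφ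
  have hφx : ∀ i : Fin n, ∀ hi : i ≠ ⟨k, hk⟩, φ x ⟨i, hi⟩ = 0 := fun i hi => by
    rw [LinearMap.mem_ker.1 hxφ]; rfl
  have ha : ∀ i : Fin n, k < (i : ℕ) → ⟪a i, x⟫ = 0 := by
    intro i hi
    have := hφx i (fun h => by rw [h] at hi; exact lt_irrefl _ hi)
    simpa [φ, hi] using this
  have hb : ∀ i : Fin n, (i : ℕ) < k → ⟪b i, x⟫ = 0 := by
    intro i hi
    have := hφx i (fun h => by rw [h] at hi; exact lt_irrefl _ hi)
    simpa [φ, hi.not_gt] using this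
  have hA : A.singularValues k * ‖x‖ ≤ ‖A x‖ := by
    refine le_of_sq_le_sq ?_ (norm_nonneg _)
    rw [mul_pow, norm_sq_eq_sum_singularValues A hn x, sum_sq_inner_eigenvectorBasis A hn x,
      Finset.mul_sum]
    refine Finset.sum_le_sum fun i _ => ?_
    rcases lt_or_ge k (i : ℕ) with hi | hi
    · simp [a, ha i hi]
    · exact mul_le_mul_of_nonneg_right (pow_le_pow_left₀ (A.singularValues_nonneg k)
        (A.singularValues_antitone hi) 2) (sq_nonneg _)
  have hB : ‖B x‖ ≤ B.singularValues k * ‖x‖ := by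
    refine le_of_sq_le_sq ?_ (mul_nonneg (B.singularValues_nonneg k) (norm_nonneg _))
    rw [mul_pow, norm_sq_eq_sum_singularValues B hn x, sum_sq_inner_eigenvectorBasis B hn x,
      Finset.mul_sum]
    refine Finset.sum_le_sum fun i _ => ?_
    rcases lt_or_ge (i : ℕ) k with hi | hi
    · simp [b, hb i hi]
    · exact mul_le_mul_of_nonneg_right (pow_le_pow_left₀ (B.singularValues_nonneg i)
        (B.singularValues_antitone hi) 2) (sq_nonneg _)
  have hx : 0 < ‖x‖ := norm_pos_iff.2 hx0
  refine le_of_mul_le_mul_right ?_ hx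
  calc A.singularValues k * ‖x‖ ≤ ‖A x‖ := hA
    _ ≤ ‖B x‖ + ‖A x - B x‖ := by
      have := norm_add_le (B x) (A x - B x)
      rwa [add_sub_cancel] at this
    _ ≤ (B.singularValues k + s) * ‖x‖ := by
      rw [add_mul]; exact add_le_add hB (h x)

end SingularValues

namespace TensorRing

theorem singularValue_le_add {ι κ : Type} [Fintype ι] [Fintype κ] [DecidableEq κ]
    (M N : Matrix ι κ ℝ) {s : ℝ} (hs : 0 ≤ s)
    (h : ∀ v, ‖Matrix.toEuclideanLin (M - N) v‖ ≤ s * ‖v‖) (k : ℕ) :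
    singularValue M k ≤ singularValue N k + s :=
  singularValues_le_add _ _ hs (fun v => by simpa using h v) _

theorem singularValue_eq_zero {ι κ : Type} [Fintype ι] [Fintype κ] [DecidableEq κ]
    (M : Matrix ι κ ℝ) {k : ℕ} (h : M.rank < k) : singularValue M k = 0 := by
  rw [singularValue, LinearMap.singularValues_eq_zero_iff_le_finrank_range,
    show Matrix.toEuclideanLin = _ from Matrix.toLpLin_eq_toLin 2 2, ← Matrix.rank_eq_finrank_range_toLin]
  -- The index is `k - 1`, counted from zero; `M.rank < k` forces `k ≥ 1`, so the truncated
  -- subtraction is exact.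
  omega

end TensorRing

end

/-! ### Cuts of the ring and the rank of a matricization. -/

section

open Module

namespace TensorRing

theorem val_finRotate {d : ℕ} (j : Fin d) :
    (finRotate d j : ℕ) = if (j : ℕ) + 1 = d then 0 else (j : ℕ) + 1 := by
  cases d with
  | zero => exact j.elim0
  | succ m =>
    split_ifs with h
    · have : j = Fin.last m := Fin.ext (by simp; omega)
      subst this; simp
    · exact coe_finRotate_of_ne_last fun h' => h (by rw [h']; simp)

/-- Cutting the ring at the bonds `lo` and `hi`. -/
theorem ringTensor_eq_sum_mul {d : ℕ} {n r : Fin d → ℕ} {τ : Equiv.Perm (Fin d)}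
    (u : Cores n r τ) (hr : ∀ j, 0 < r j) {lo hi : Fin d} (hlt : lo < hi) :
    ∃ f g : (∀ i, Fin (n i)) → Fin (r lo) × Fin (r hi) → ℝ,
      (∀ x, ringTensor u x = ∑ s, f x s * g x s) ∧
      (∀ x x', (∀ i, lo ≤ τ.symm i ∧ τ.symm i < hi → x i = x' i) → f x = f x') ∧
      (∀ x x', (∀ i, ¬ (lo ≤ τ.symm i ∧ τ.symm i < hi) → x i = x' i) → g x = g x') := by
  classical
  let S : Fin d → Prop := fun i => lo ≤ τ.symm i ∧ τ.symm i < hi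
  -- Bond `j` joins positions `j - 1` and `j`. The nodes at positions in `[lo, hi)` touch only the
  -- bonds from `lo` to `hi`, and the other nodes touch none strictly between; only the bonds `lo`
  -- and `hi` are shared.
  let p : Fin d → Prop := fun j => lo < j ∧ j < hi
  let e := Equiv.piEquivPiSubtypeProd p (fun j => Fin (r j))
  let k₀ : ∀ j, Fin (r j) := fun j => ⟨0, hr j⟩
  let fac : (∀ i, Fin (n i)) → (∀ j, Fin (r j)) → Fin d → ℝ := fun x k i =>
    u i (k (τ.symm i)) (x i) (k (finRotate d (τ.symm i)))
  let A : (∀ i, Fin (n i)) → (∀ j, Fin (r j)) → ℝ := fun x k =>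
    ∏ i with S i, fac x k i
  let B : (∀ i, Fin (n i)) → (∀ j, Fin (r j)) → ℝ := fun x k =>
    ∏ i with ¬ S i, fac x k i
  let ext : Fin (r lo) × Fin (r hi) → (∀ j : {j // ¬ p j}, Fin (r j)) := fun s j =>
    Function.update (Function.update k₀ lo s.1) hi s.2 j
  have hlo : ¬ p lo := fun h => lt_irrefl _ h.1
  have hhi : ¬ p hi := fun h => lt_irrefl _ h.2
  let ends : (∀ j : {j // ¬ p j}, Fin (r j)) → Fin (r lo) × Fin (r hi) := fun k₂ =>
    (k₂ ⟨lo, hlo⟩, k₂ ⟨hi, hhi⟩)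
  have hA : ∀ x k₁ k₂, A x (e.symm (k₁, k₂)) = A x (e.symm (k₁, ext (ends k₂))) := by
    intro x k₁ k₂
    have hj : ∀ j, lo ≤ j → j ≤ hi → e.symm (k₁, k₂) j = e.symm (k₁, ext (ends k₂)) j := by
      intro j h1 h2
      simp only [e, Equiv.piEquivPiSubtypeProd_symm_apply]
      split_ifs with hp
      · rfl
      · rcases h1.eq_or_lt with rfl | h1
        · simp [ext, ends, Function.update_of_ne hlt.ne]
        · rcases h2.eq_or_lt with rfl | h2
          · simp [ext, ends]
          · exact absurd ⟨h1, h2⟩ hp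
    refine Finset.prod_congr rfl fun i hi' => ?_
    have hS : S i := (Finset.mem_filter.1 hi').2
    simp only [fac]
    rw [hj _ hS.1 hS.2.le]
    have h3 := val_finRotate (τ.symm i)
    have h4 := hS.1
    have h5 := hS.2
    rw [Fin.le_def] at h4
    rw [Fin.lt_def] at h5
    rw [if_neg (by have := hi.isLt; omega)] at h3
    rw [hj _ (by rw [Fin.le_def]; omega) (by rw [Fin.le_def]; omega)]
  have hB : ∀ x k₁ k₁' k₂, B x (e.symm (k₁, k₂)) = B x (e.symm (k₁', k₂)) := by
    intro x k₁ k₁' k₂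
    have hj : ∀ j, ¬ p j → e.symm (k₁, k₂) j = e.symm (k₁', k₂) j := by
      intro j hp
      simp only [e, Equiv.piEquivPiSubtypeProd_symm_apply, dif_neg hp]
    refine Finset.prod_congr rfl fun i hi' => ?_
    have hS : ¬ S i := (Finset.mem_filter.1 hi').2
    have h3 := val_finRotate (τ.symm i)
    simp only [fac]
    rw [hj, hj]
    · simp only [p, S, Fin.lt_def, Fin.le_def] at hS ⊢
      rw [h3]
      split_ifs <;> omega
    · simp only [p, S, Fin.lt_def, Fin.le_def] at hS ⊢
      omega
  -- The inner factor sums over the interior bonds, the outer factor over the other bonds with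
  -- prescribed end values. The defaults taken from `k₀` are harmless because by `hA` and `hB`
  -- neither factor sees them.
  refine ⟨fun x s => ∑ k₁, A x (e.symm (k₁, ext s)),
    fun x s => ∑ k₂ with ends k₂ = s, B x (e.symm ((e k₀).1, k₂)), fun x => ?_, fun x x' h => ?_,
    fun x x' h => ?_⟩
  · have h1 : ringTensor u x = ∑ k, A x k * B x k := by
      refine Finset.sum_congr rfl fun k _ => ?_
      exact (Finset.prod_filter_mul_prod_filter_not Finset.univ S _).symm
    rw [h1, ← e.symm.sum_comp, Fintype.sum_prod_type, Finset.sum_comm]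
    have h2 : ∀ s, (∑ k₁, A x (e.symm (k₁, ext s))) *
        ∑ k₂ with ends k₂ = s, B x (e.symm ((e k₀).1, k₂)) =
        ∑ k₂ with ends k₂ = s, (∑ k₁, A x (e.symm (k₁, ext (ends k₂)))) *
          B x (e.symm ((e k₀).1, k₂)) := by
      intro s
      rw [Finset.mul_sum]
      refine Finset.sum_congr rfl fun k₂ hk => ?_
      rw [(Finset.mem_filter.1 hk).2]
    simp only [h2]
    rw [Finset.sum_fiberwise]
    refine Finset.sum_congr rfl fun k₂ _ => ?_
    rw [Finset.sum_mul]
    refine Finset.sum_congr rfl fun k₁ _ => ?_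
    rw [hA, hB x k₁ (e k₀).1]
  · funext s
    refine Finset.sum_congr rfl fun k₁ _ => Finset.prod_congr rfl fun i hi' => ?_
    simp only [fac]
    rw [h i (Finset.mem_filter.1 hi').2]
  · funext s
    refine Finset.sum_congr rfl fun k₁ _ => Finset.prod_congr rfl fun i hi' => ?_
    simp only [fac]
    rw [h i (Finset.mem_filter.1 hi').2]

/-- The cut writes the matrix as a product through the values of the two cut bonds. Each factor
ignores the indices on the other side, so these may be frozen at `y`. The arc may hold the row pair
or the column pair. -/
theorem rank_matricization_le {d : ℕ} {n r : Fin d → ℕ} {τ : Equiv.Perm (Fin d)}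
    (u : Cores n r τ) (hr : ∀ j, 0 < r j) (y : ∀ i, Fin (n i)) {lo hi : Fin d} (hlt : lo < hi)
    {a b c e : Fin d}
    (h : (∀ i, i = a ∨ i = b → lo ≤ τ.symm i ∧ τ.symm i < hi) ∧
        (∀ i, i = c ∨ i = e → ¬ (lo ≤ τ.symm i ∧ τ.symm i < hi)) ∨
      (∀ i, i = a ∨ i = b → ¬ (lo ≤ τ.symm i ∧ τ.symm i < hi)) ∧
        (∀ i, i = c ∨ i = e → lo ≤ τ.symm i ∧ τ.symm i < hi)) :
    (matricization (ringTensor u) y a b c e).rank ≤ r lo * r hi := by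
  obtain ⟨f, g, hfg, hf, hg⟩ := ringTensor_eq_sum_mul u hr hlt
  let z : Fin (n a) × Fin (n b) → Fin (n c) × Fin (n e) → ∀ i, Fin (n i) := fun p q =>
    Function.update (Function.update (Function.update (Function.update y a p.1) b p.2) c q.1)
      e q.2
  have hrow : ∀ p q q' i, i ≠ c → i ≠ e → z p q i = z p q' i := by
    intro p q q' i hc he
    simp only [z, Function.update_of_ne he, Function.update_of_ne hc]
  have hcol : ∀ p p' q i, i ≠ a → i ≠ b → z p q i = z p' q i := by
    intro p p' q i ha hb
    simp only [z]
    by_cases he : i = e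
    · subst he; simp
    by_cases hc : i = c
    · subst hc; simp [Function.update_of_ne he]
    simp only [Function.update_of_ne he, Function.update_of_ne hc, Function.update_of_ne hb,
      Function.update_of_ne ha]
  have main : ∃ (P : Matrix (Fin (n a) × Fin (n b)) (Fin (r lo) × Fin (r hi)) ℝ)
      (Q : Matrix (Fin (r lo) × Fin (r hi)) (Fin (n c) × Fin (n e)) ℝ),
      matricization (ringTensor u) y a b c e = P * Q := by
    rcases h with ⟨h1, h2⟩ | ⟨h1, h2⟩
    · refine ⟨Matrix.of fun p s => f (z p (y c, y e)) s, Matrix.of fun s q => g (z (y a, y b) q) s,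
        ?_⟩
      ext p q
      rw [Matrix.mul_apply]
      refine (hfg (z p q)).trans (Finset.sum_congr rfl fun s _ => ?_)
      rw [hf (z p q) (z p (y c, y e)) fun i hi => hrow _ _ _ _ (fun hc => h2 i (Or.inl hc) hi)
          fun he => h2 i (Or.inr he) hi,
        hg (z p q) (z (y a, y b) q) fun i hi => hcol _ _ _ _ (fun ha => hi (h1 i (Or.inl ha)))
          fun hb => hi (h1 i (Or.inr hb))]
      rfl
    · refine ⟨Matrix.of fun p s => g (z p (y c, y e)) s, Matrix.of fun s q => f (z (y a, y b) q) s,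
        ?_⟩
      ext p q
      rw [Matrix.mul_apply]
      refine (hfg (z p q)).trans (Finset.sum_congr rfl fun s _ => ?_)
      rw [hg (z p q) (z p (y c, y e)) fun i hi => hrow _ _ _ _ (fun hc => hi (h2 i (Or.inl hc)))
          fun he => hi (h2 i (Or.inr he)),
        hf (z p q) (z (y a, y b) q) fun i hi => hcol _ _ _ _ (fun ha => h1 i (Or.inl ha) hi)
          fun hb => h1 i (Or.inr hb) hi, mul_comm]
      rfl
  obtain ⟨P, Q, hPQ⟩ := main
  rw [hPQ]
  refine (Matrix.rank_mul_le_left P Q).trans ((Matrix.rank_le_card_width P).trans ?_)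
  simp

/-- The pairs `a, b` and `c, e` are not separated by each other on the ring. -/
def Unlinked {d : ℕ} (τ : Equiv.Perm (Fin d)) (a b c e : Fin d) : Prop :=
  ∃ lo hi : Fin d, lo < hi ∧
    ((∀ i, i = a ∨ i = b → lo ≤ τ.symm i ∧ τ.symm i < hi) ∧
        (∀ i, i = c ∨ i = e → ¬ (lo ≤ τ.symm i ∧ τ.symm i < hi)) ∨
      (∀ i, i = a ∨ i = b → ¬ (lo ≤ τ.symm i ∧ τ.symm i < hi)) ∧
        (∀ i, i = c ∨ i = e → lo ≤ τ.symm i ∧ τ.symm i < hi))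

theorem singularValue_matricization_eq_zero {d : ℕ} {n r : Fin d → ℕ} {τ : Equiv.Perm (Fin d)}
    (u : Cores n r τ) {R : ℕ} (hR : AdmissibleRank n r R) (y : ∀ i, Fin (n i)) {a b c e : Fin d}
    (h : Unlinked τ a b c e) :
    singularValue (matricization (ringTensor u) y a b c e) (R ^ 4) = 0 := by
  obtain ⟨lo, hi, hlt, h⟩ := h
  obtain ⟨hR0, -, hr, hr'⟩ := hR
  refine singularValue_eq_zero _
    ((rank_matricization_le u (fun j => hR0.trans_le (hr' j)) y hlt h).trans_lt ?_)
  calc r lo * r hi < R ^ 2 * R ^ 2 :=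
        Nat.mul_lt_mul_of_lt_of_le (hr lo) (hr hi).le (by positivity)
    _ = R ^ 4 := by ring

/-- The pairs of neighbours among four indices in correct order are unlinked. -/
theorem CorrectOrder.unlinked {d : ℕ} {τ : Equiv.Perm (Fin d)} {p₀ p₁ p₂ p₃ : Fin d}
    (h : CorrectOrder τ ![p₀, p₁, p₂, p₃]) {a b c e : Fin d}
    (hab : (∀ i, (i = a ∨ i = b ↔ i = p₀ ∨ i = p₁)) ∧ (∀ i, (i = c ∨ i = e ↔ i = p₂ ∨ i = p₃)) ∨
      (∀ i, (i = a ∨ i = b ↔ i = p₀ ∨ i = p₃)) ∧ (∀ i, (i = c ∨ i = e ↔ i = p₁ ∨ i = p₂))) :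
    Unlinked τ a b c e := by
  -- For increasing positions the arcs `[q₀, q₂)` and `[q₁, q₃)` isolate all pairs of neighbours,
  -- either inside or in the complement. The eight cyclic cases below are relabellings of this one.
  have key : ∀ q₀ q₁ q₂ q₃ : Fin d, (τ.symm q₀ < τ.symm q₁ ∧ τ.symm q₁ < τ.symm q₂ ∧
      τ.symm q₂ < τ.symm q₃) →
      ((∀ i, (i = a ∨ i = b ↔ i = q₀ ∨ i = q₁)) ∧ (∀ i, (i = c ∨ i = e ↔ i = q₂ ∨ i = q₃)) ∨
      (∀ i, (i = a ∨ i = b ↔ i = q₂ ∨ i = q₃)) ∧ (∀ i, (i = c ∨ i = e ↔ i = q₀ ∨ i = q₁)) ∨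
      (∀ i, (i = a ∨ i = b ↔ i = q₁ ∨ i = q₂)) ∧ (∀ i, (i = c ∨ i = e ↔ i = q₀ ∨ i = q₃)) ∨
      (∀ i, (i = a ∨ i = b ↔ i = q₀ ∨ i = q₃)) ∧ (∀ i, (i = c ∨ i = e ↔ i = q₁ ∨ i = q₂))) →
      Unlinked τ a b c e := by
    rintro q₀ q₁ q₂ q₃ ⟨h1, h2, h3⟩ (⟨ha, hc⟩ | ⟨ha, hc⟩ | ⟨ha, hc⟩ | ⟨ha, hc⟩)
    · refine ⟨τ.symm q₀, τ.symm q₂, h1.trans h2, Or.inl ⟨fun i hi => ?_, fun i hi => ?_⟩⟩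
      · rcases (ha i).1 hi with rfl | rfl <;> constructor <;> order
      · rcases (hc i).1 hi with rfl | rfl <;> rintro ⟨h5, h6⟩ <;> order
    · refine ⟨τ.symm q₀, τ.symm q₂, h1.trans h2, Or.inr ⟨fun i hi => ?_, fun i hi => ?_⟩⟩
      · rcases (ha i).1 hi with rfl | rfl <;> rintro ⟨h5, h6⟩ <;> order
      · rcases (hc i).1 hi with rfl | rfl <;> constructor <;> order
    · refine ⟨τ.symm q₁, τ.symm q₃, h2.trans h3, Or.inl ⟨fun i hi => ?_, fun i hi => ?_⟩⟩
      · rcases (ha i).1 hi with rfl | rfl <;> constructor <;> order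
      · rcases (hc i).1 hi with rfl | rfl <;> rintro ⟨h5, h6⟩ <;> order
    · refine ⟨τ.symm q₁, τ.symm q₃, h2.trans h3, Or.inr ⟨fun i hi => ?_, fun i hi => ?_⟩⟩
      · rcases (ha i).1 hi with rfl | rfl <;> rintro ⟨h5, h6⟩ <;> order
      · rcases (hc i).1 hi with rfl | rfl <;> constructor <;> order
  have swap : ∀ {a b x y : Fin d}, (∀ i, (i = a ∨ i = b ↔ i = x ∨ i = y)) →
      ∀ i, (i = a ∨ i = b ↔ i = y ∨ i = x) := fun h i => (h i).trans or_comm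
  obtain ⟨s, hs⟩ := h
  fin_cases s <;> rcases hs with ⟨h1, h2, h3⟩ | ⟨h1, h2, h3⟩ <;>
    simp only [Fin.isValue, Fin.mk_one, Fin.zero_eta, Fin.reduceFinMk, Fin.reduceAdd,
      Matrix.cons_val, gt_iff_lt, zero_add] at h1 h2 h3
  on_goal 1 => refine key p₀ p₁ p₂ p₃ ⟨h1, h2, h3⟩ ?_
  on_goal 2 => refine key p₃ p₂ p₁ p₀ ⟨h3, h2, h1⟩ ?_
  on_goal 3 => refine key p₁ p₂ p₃ p₀ ⟨h1, h2, h3⟩ ?_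
  on_goal 4 => refine key p₀ p₃ p₂ p₁ ⟨h3, h2, h1⟩ ?_
  on_goal 5 => refine key p₂ p₃ p₀ p₁ ⟨h1, h2, h3⟩ ?_
  on_goal 6 => refine key p₁ p₀ p₃ p₂ ⟨h3, h2, h1⟩ ?_
  on_goal 7 => refine key p₃ p₀ p₁ p₂ ⟨h1, h2, h3⟩ ?_
  on_goal 8 => refine key p₂ p₁ p₀ p₃ ⟨h3, h2, h1⟩ ?_
  all_goals
    clear key
    rcases hab with ⟨ha, hc⟩ | ⟨ha, hc⟩
    all_goals
      have ha' := swap ha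
      have hc' := swap hc
      solve_by_elim (maxDepth := 8) [Or.inl, Or.inr, And.intro]

end TensorRing

end

/-! ### Cyclic order of four positions and its symmetries. -/

section

open Module

namespace TensorRing

/-- Four positions on the ring are visited in this order, in one of the two directions. -/
def CyclicChain {d : ℕ} (P : Fin 4 → Fin d) : Prop :=
  ∃ s : Fin 4, (P s < P (s + 1) ∧ P (s + 1) < P (s + 2) ∧ P (s + 2) < P (s + 3)) ∨
    (P s > P (s + 1) ∧ P (s + 1) > P (s + 2) ∧ P (s + 2) > P (s + 3))

theorem correctOrder_iff_cyclicChain {d : ℕ} {τ : Equiv.Perm (Fin d)} {q : Fin 4 → Fin d} :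
    CorrectOrder τ q ↔ CyclicChain fun s => τ.symm (q s) := Iff.rfl

theorem CyclicChain.rotate {d : ℕ} {P : Fin 4 → Fin d} (h : CyclicChain P) (k : Fin 4) :
    CyclicChain fun s => P (s + k) := by
  obtain ⟨s, hs⟩ := h
  refine ⟨s - k, ?_⟩
  have h0 : s - k + k = s := by abel
  have h1 : ∀ j : Fin 4, s - k + j + k = s + j := fun j => by abel
  simpa only [h0, h1] using hs

theorem CyclicChain.of_rotate {d : ℕ} {P : Fin 4 → Fin d} (k : Fin 4)
    (h : CyclicChain fun s => P (s + k)) : CyclicChain P := by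
  simpa using h.rotate (-k)

theorem CyclicChain.comp_rev {d : ℕ} {P : Fin 4 → Fin d} (h : CyclicChain P) :
    CyclicChain fun s => (P s).rev := by
  obtain ⟨s, hs⟩ := h
  refine ⟨s, ?_⟩
  simp only [Fin.rev_lt_rev, gt_iff_lt] at hs ⊢
  exact hs.symm

theorem cyclicChain_rev_iff {d : ℕ} {P : Fin 4 → Fin d} :
    CyclicChain (fun s => (P s).rev) ↔ CyclicChain P :=
  ⟨fun h => by simpa using h.comp_rev, CyclicChain.comp_rev⟩

theorem cyclicChain_of_lt {d : ℕ} {P : Fin 4 → Fin d}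
    (h : P 0 < P 1 ∧ P 1 < P 2 ∧ P 2 < P 3) : CyclicChain P :=
  ⟨0, Or.inl h⟩

/-- Only the largest position can wrap around to zero, and then the chain starts with it. -/
theorem CyclicChain.finRotate_of_lt {d : ℕ} {P : Fin 4 → Fin d}
    (h : P 0 < P 1 ∧ P 1 < P 2 ∧ P 2 < P 3) : CyclicChain fun s => finRotate d (P s) := by
  have e0 := val_finRotate (P 0)
  have e1 := val_finRotate (P 1)
  have e2 := val_finRotate (P 2)
  have e3 := val_finRotate (P 3)
  have b3 := (P 3).isLt
  obtain ⟨h1, h2, h3⟩ := h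
  rw [Fin.lt_def] at h1 h2 h3
  rw [if_neg (by omega)] at e0 e1 e2
  by_cases h4 : (P 3 : ℕ) + 1 = d
  · rw [if_pos h4] at e3
    refine .of_rotate 3 (cyclicChain_of_lt ?_)
    simp only [Fin.lt_def]
    change (finRotate d (P 3) : ℕ) < (finRotate d (P 0) : ℕ) ∧
      (finRotate d (P 0) : ℕ) < (finRotate d (P 1) : ℕ) ∧
      (finRotate d (P 1) : ℕ) < (finRotate d (P 2) : ℕ)
    omega
  · rw [if_neg h4] at e3
    refine cyclicChain_of_lt ?_
    simp only [Fin.lt_def]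
    omega

theorem CyclicChain.finRotate_symm_of_lt {d : ℕ} {P : Fin 4 → Fin d}
    (h : P 0 < P 1 ∧ P 1 < P 2 ∧ P 2 < P 3) : CyclicChain fun s => (finRotate d).symm (P s) := by
  obtain ⟨h1, h2, h3⟩ := h
  obtain ⟨Q, rfl⟩ : ∃ Q : Fin 4 → Fin d, P = fun s => finRotate d (Q s) :=
    ⟨fun s => (finRotate d).symm (P s), funext fun s => ((finRotate d).apply_symm_apply _).symm⟩
  simp only [Equiv.symm_apply_apply]
  dsimp only at h1 h2 h3
  have e0 := val_finRotate (Q 0)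
  have e1 := val_finRotate (Q 1)
  have e2 := val_finRotate (Q 2)
  have e3 := val_finRotate (Q 3)
  have b0 := (Q 0).isLt
  have b1 := (Q 1).isLt
  have b2 := (Q 2).isLt
  have b3 := (Q 3).isLt
  rw [Fin.lt_def] at h1 h2 h3
  rw [if_neg (fun h => by rw [if_pos h] at e1; omega)] at e1
  rw [if_neg (fun h => by rw [if_pos h] at e2; omega)] at e2
  rw [if_neg (fun h => by rw [if_pos h] at e3; omega)] at e3
  by_cases h4 : (Q 0 : ℕ) + 1 = d
  · refine .of_rotate 1 (cyclicChain_of_lt ?_)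
    simp only [Fin.lt_def]
    change (Q 1 : ℕ) < (Q 2 : ℕ) ∧ (Q 2 : ℕ) < (Q 3 : ℕ) ∧ (Q 3 : ℕ) < (Q 0 : ℕ)
    omega
  · rw [if_neg h4] at e0
    refine cyclicChain_of_lt ?_
    simp only [Fin.lt_def]
    omega

theorem CyclicChain.reverse {d : ℕ} {P : Fin 4 → Fin d} (h : CyclicChain P) :
    CyclicChain fun s => P (-s) := by
  obtain ⟨s, hs⟩ := h
  refine ⟨-(s + 3), ?_⟩
  have e0 : -(-(s + 3)) = s + 3 := by abel
  have e1 : -(-(s + 3) + 1) = s + 2 := by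
    rw [show (3 : Fin 4) = 2 + 1 from rfl]; abel
  have e2 : -(-(s + 3) + 2) = s + 1 := by
    rw [show (3 : Fin 4) = 1 + 2 from rfl]; abel
  have e3 : -(-(s + 3) + 3) = s := by abel
  simp only [e0, e1, e2, e3]
  rcases hs with ⟨h1, h2, h3⟩ | ⟨h1, h2, h3⟩
  · exact Or.inr ⟨h3, h2, h1⟩
  · exact Or.inl ⟨h3, h2, h1⟩

/-- To check a map of positions preserves cyclic chains, increasing ones suffice. -/
theorem CyclicChain.map {d : ℕ} {g : Fin d → Fin d}
    (hg : ∀ P : Fin 4 → Fin d, P 0 < P 1 ∧ P 1 < P 2 ∧ P 2 < P 3 → CyclicChain fun s => g (P s))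
    {P : Fin 4 → Fin d} (h : CyclicChain P) : CyclicChain fun s => g (P s) := by
  have inc : ∀ (P : Fin 4 → Fin d) (s : Fin 4),
      (P s < P (s + 1) ∧ P (s + 1) < P (s + 2) ∧ P (s + 2) < P (s + 3)) →
      CyclicChain fun s => g (P s) := by
    intro P s hs
    refine .of_rotate s (hg (fun j => P (j + s)) ?_)
    simpa only [zero_add, add_comm s] using hs
  obtain ⟨s, hs | ⟨h1, h2, h3⟩⟩ := h
  · exact inc P s hs
  · have := (inc (fun j => P (-j)) (-(s + 3)) (by
      have e0 : -(-(s + 3)) = s + 3 := by abel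
      have e1 : -(-(s + 3) + 1) = s + 2 := by
        rw [show (3 : Fin 4) = 2 + 1 from rfl]; abel
      have e2 : -(-(s + 3) + 2) = s + 1 := by
        rw [show (3 : Fin 4) = 1 + 2 from rfl]; abel
      have e3 : -(-(s + 3) + 3) = s := by abel
      simp only [e0, e1, e2, e3]
      exact ⟨h3, h2, h1⟩)).reverse
    simpa using this

theorem cyclicChain_finRotate_iff {d : ℕ} {P : Fin 4 → Fin d} :
    CyclicChain (fun s => finRotate d (P s)) ↔ CyclicChain P :=
  ⟨fun h => by
    simpa only [Equiv.symm_apply_apply] using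
      h.map (g := (finRotate d).symm) fun P hP => CyclicChain.finRotate_symm_of_lt hP,
    fun h => h.map fun P hP => CyclicChain.finRotate_of_lt hP⟩

theorem cyclicChain_finRotate_pow_iff {d : ℕ} (k : ℕ) {P : Fin 4 → Fin d} :
    CyclicChain (fun s => (finRotate d ^ k) (P s)) ↔ CyclicChain P := by
  induction k with
  | zero => simp
  | succ k ih =>
    rw [← ih, ← cyclicChain_finRotate_iff (P := fun s => (finRotate d ^ k) (P s)), pow_succ']
    rfl

/-- Writing the indices as images of positions under the second permutation cancels `τ`, and
invariance under rotation and reflection of positions remains. The analysis may thus use any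
convenient description of the ring. -/
theorem SameRing.correctOrder_iff {d : ℕ} {τ τ' : Equiv.Perm (Fin d)} (h : SameRing τ τ')
    (q : Fin 4 → Fin d) : CorrectOrder τ q ↔ CorrectOrder τ' q := by
  obtain ⟨k, -, l, hl, rfl⟩ := h
  rw [correctOrder_iff_cyclicChain, correctOrder_iff_cyclicChain]
  obtain ⟨ρ, hρ⟩ : ∃ ρ, ρ = τ * finRotate d ^ k * (Fin.revPerm : Equiv.Perm (Fin d)) ^ l :=
    ⟨_, rfl⟩
  rw [← hρ]
  obtain ⟨P, rfl⟩ : ∃ P : Fin 4 → Fin d, q = fun s => ρ (P s) := ⟨fun s => ρ.symm (q s), by simp⟩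
  simp only [Equiv.symm_apply_apply]
  simp only [hρ, Equiv.Perm.mul_apply, Equiv.symm_apply_apply, cyclicChain_finRotate_pow_iff]
  interval_cases l
  · rfl
  · exact cyclicChain_rev_iff

open Classical in
/-- The answer of the algorithm for four indices in the absence of noise. -/
noncomputable def exactAnswer {d : ℕ} (τ : Equiv.Perm (Fin d)) (q : Fin 4 → Fin d) :
    Fin 4 → Fin d :=
  if CorrectOrder τ ![q 0, q 2, q 1, q 3] then ![q 0, q 2, q 1, q 3]
  else if CorrectOrder τ ![q 0, q 1, q 2, q 3] then ![q 0, q 1, q 2, q 3]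
  else ![q 0, q 1, q 3, q 2]

theorem SameRing.exactAnswer_eq {d : ℕ} {τ τ' : Equiv.Perm (Fin d)} (h : SameRing τ τ') :
    exactAnswer τ = exactAnswer τ' := by
  have : CorrectOrder τ = CorrectOrder τ' := funext fun q => propext (h.correctOrder_iff q)
  unfold exactAnswer
  rw [this]

theorem correctOrder_cons_iff {d : ℕ} {τ : Equiv.Perm (Fin d)} (a b c e : Fin d) :
    CorrectOrder τ ![a, b, c, e] ↔
      (τ.symm a < τ.symm b ∧ τ.symm b < τ.symm c ∧ τ.symm c < τ.symm e) ∨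
      (τ.symm b < τ.symm c ∧ τ.symm c < τ.symm e ∧ τ.symm e < τ.symm a) ∨
      (τ.symm c < τ.symm e ∧ τ.symm e < τ.symm a ∧ τ.symm a < τ.symm b) ∨
      (τ.symm e < τ.symm a ∧ τ.symm a < τ.symm b ∧ τ.symm b < τ.symm c) ∨
      (τ.symm e < τ.symm c ∧ τ.symm c < τ.symm b ∧ τ.symm b < τ.symm a) ∨
      (τ.symm a < τ.symm e ∧ τ.symm e < τ.symm c ∧ τ.symm c < τ.symm b) ∨
      (τ.symm b < τ.symm a ∧ τ.symm a < τ.symm e ∧ τ.symm e < τ.symm c) ∨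
      (τ.symm c < τ.symm b ∧ τ.symm b < τ.symm a ∧ τ.symm a < τ.symm e) := by
  unfold CorrectOrder
  constructor
  · rintro ⟨s, hs⟩
    fin_cases s <;> simp only [Fin.isValue, Fin.mk_one, Fin.zero_eta, Fin.reduceFinMk,
      Fin.reduceAdd, Matrix.cons_val, gt_iff_lt, zero_add] at hs <;> rcases hs with ⟨h1, h2, h3⟩ | ⟨h1, h2, h3⟩ <;>
      simp only [h1, h2, h3, and_self, true_or, or_true]
  · rintro (h | h | h | h | h | h | h | h)
    · exact ⟨0, Or.inl h⟩
    · exact ⟨1, Or.inl h⟩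
    · exact ⟨2, Or.inl h⟩
    · exact ⟨3, Or.inl h⟩
    · exact ⟨0, Or.inr ⟨h.2.2, h.2.1, h.1⟩⟩
    · exact ⟨1, Or.inr ⟨h.2.2, h.2.1, h.1⟩⟩
    · exact ⟨2, Or.inr ⟨h.2.2, h.2.1, h.1⟩⟩
    · exact ⟨3, Or.inr ⟨h.2.2, h.2.1, h.1⟩⟩

/-- Four different indices have only three cyclic orders up to reflection, and the three branches
list them; the last branch is checked over all linear orders. -/
theorem correctOrder_exactAnswer {d : ℕ} (τ : Equiv.Perm (Fin d)) {q : Fin 4 → Fin d}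
    (hq : Function.Injective q) : CorrectOrder τ (exactAnswer τ q) := by
  unfold exactAnswer
  split_ifs with h1 h2
  · exact h1
  · exact h2
  have hne : ∀ i j : Fin 4, i ≠ j → τ.symm (q i) < τ.symm (q j) ∨ τ.symm (q j) < τ.symm (q i) :=
    fun i j hij => lt_or_gt_of_ne fun h => hij (hq (τ.symm.injective h))
  have h01 := hne 0 1 (by decide)
  have h02 := hne 0 2 (by decide)
  have h03 := hne 0 3 (by decide)
  have h12 := hne 1 2 (by decide)
  have h13 := hne 1 3 (by decide)
  have h23 := hne 2 3 (by decide)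
  rw [correctOrder_cons_iff] at h1 h2 ⊢
  generalize τ.symm (q 0) = a at *
  generalize τ.symm (q 1) = b at *
  generalize τ.symm (q 2) = c at *
  generalize τ.symm (q 3) = e at *
  clear hne
  rcases h01 with h01 | h01 <;> rcases h02 with h02 | h02 <;> rcases h03 with h03 | h03 <;>
    rcases h12 with h12 | h12 <;> rcases h13 with h13 | h13 <;> rcases h23 with h23 | h23 <;>
    simp [h01, h02, h03, h12, h13, h23, h01.not_gt, h02.not_gt, h03.not_gt, h12.not_gt,
      h13.not_gt, h23.not_gt] at h1 h2 ⊢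

end TensorRing

end

/-! ### Four indices under small noise. -/

section

open Module

namespace TensorRing

/-- The noise in the matricization has operator norm at most `s`. -/
def SmallNoise {d : ℕ} {n : Fin d → ℕ} (E : Tensor n) (y : ∀ i, Fin (n i)) (s : ℝ)
    (a b c e : Fin d) : Prop :=
  ∀ v, ‖Matrix.toEuclideanLin (matricization E y a b c e) v‖ ≤ s * ‖v‖

theorem singularValue_noisy_le {d : ℕ} {n : Fin d → ℕ} {X E : Tensor n} {y : ∀ i, Fin (n i)} {s : ℝ}
    (hs : 0 ≤ s) {a b c e : Fin d} (h : SmallNoise E y s a b c e) (k : ℕ) :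
    singularValue (matricization (X + E) y a b c e) k ≤
      singularValue (matricization X y a b c e) k + s := by
  refine singularValue_le_add _ _ hs (fun v => ?_) k
  have : matricization (X + E) y a b c e - matricization X y a b c e = matricization E y a b c e :=
    sub_eq_of_eq_add' rfl
  rw [this]
  exact h v

theorem singularValue_le_noisy {d : ℕ} {n : Fin d → ℕ} {X E : Tensor n} {y : ∀ i, Fin (n i)} {s : ℝ}
    (hs : 0 ≤ s) {a b c e : Fin d} (h : SmallNoise E y s a b c e) (k : ℕ) :
    singularValue (matricization X y a b c e) k ≤
      singularValue (matricization (X + E) y a b c e) k + s := by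
  refine singularValue_le_add _ _ hs (fun v => ?_) k
  have : matricization X y a b c e - matricization (X + E) y a b c e =
      -matricization E y a b c e := by
    rw [← neg_sub, neg_inj]
    exact sub_eq_of_eq_add' rfl
  rw [this, map_neg, LinearMap.neg_apply, norm_neg]
  exact h v

/-- With little noise, the algorithm for four indices gives the exact answer. -/
theorem orderFour_eq_exactAnswer {d : ℕ} {n r : Fin d → ℕ} {τ : Equiv.Perm (Fin d)}
    {u : Cores n r τ} {R : ℕ} {σ : ℝ} (hR : AdmissibleRank n r R) (hσ : UniformGap u R σ)
    {E : Tensor n} {y : ∀ i, Fin (n i)} {s : ℝ} (hs : 0 ≤ s) (hsσ : 2 * s < σ)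
    {q : Fin 4 → Fin d} (hq : Function.Injective q)
    (h₁ : SmallNoise E y s (q 0) (q 1) (q 2) (q 3))
    (h₂ : SmallNoise E y s (q 0) (q 2) (q 1) (q 3))
    (h₃ : SmallNoise E y s (q 0) (q 3) (q 1) (q 2)) :
    orderFour R (ringTensor u + E) y q = some (exactAnswer τ q) := by
  -- The noiseless values are zero for the neighbour pairings and at least `σ` for the crossing one.
  -- Each moves by at most `s`, so `2 * s < σ` keeps them on different sides of `s`.
  have low : ∀ {p₀ p₁ p₂ p₃ a b c e : Fin d}, CorrectOrder τ ![p₀, p₁, p₂, p₃] →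
      SmallNoise E y s a b c e →
      ((∀ i, (i = a ∨ i = b ↔ i = p₀ ∨ i = p₁)) ∧ (∀ i, (i = c ∨ i = e ↔ i = p₂ ∨ i = p₃)) ∨
      (∀ i, (i = a ∨ i = b ↔ i = p₀ ∨ i = p₃)) ∧ (∀ i, (i = c ∨ i = e ↔ i = p₁ ∨ i = p₂))) →
      singularValue (matricization (ringTensor u + E) y a b c e) (R ^ 4) ≤ s := by
    intro p₀ p₁ p₂ p₃ a b c e h hE hab
    have := singularValue_noisy_le (X := ringTensor u) hs hE (R ^ 4)
    rwa [singularValue_matricization_eq_zero u hR y (h.unlinked hab), zero_add] at this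
  have high : ∀ {p₀ p₁ p₂ p₃ : Fin d}, CorrectOrder τ ![p₀, p₁, p₂, p₃] →
      SmallNoise E y s p₀ p₂ p₁ p₃ →
      s < singularValue (matricization (ringTensor u + E) y p₀ p₂ p₁ p₃) (R ^ 4) := by
    intro p₀ p₁ p₂ p₃ h hE
    have h1 := singularValue_le_noisy (X := ringTensor u) hs hE (R ^ 4)
    have h2 : σ ≤ singularValue (matricization (ringTensor u) y p₀ p₂ p₁ p₃) (R ^ 4) := hσ _ h y
    linarith
  have hex := correctOrder_exactAnswer τ hq
  unfold orderFour
  unfold exactAnswer at hex ⊢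
  dsimp only
  split_ifs at hex with c1 c2
  · have g := high c1 h₁
    have l2 := low c1 h₂ (Or.inl ⟨fun _ => Iff.rfl, fun _ => Iff.rfl⟩)
    have l3 := low c1 h₃ (Or.inr ⟨fun _ => Iff.rfl, fun _ => or_comm⟩)
    rw [if_pos (max_lt (l2.trans_lt g) (l3.trans_lt g)), if_pos c1]
  · have g := high c2 h₂
    have l1 := low c2 h₁ (Or.inl ⟨fun _ => Iff.rfl, fun _ => Iff.rfl⟩)
    have l3 := low c2 h₃ (Or.inr ⟨fun _ => Iff.rfl, fun _ => Iff.rfl⟩)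
    rw [if_neg fun h => absurd ((le_max_left _ _).trans_lt h) (l1.trans_lt g).not_gt,
      if_pos (max_lt (l1.trans_lt g) (l3.trans_lt g)), if_neg c1, if_pos c2]
  · have g := high hex h₃
    have l1 := low hex h₁ (Or.inl ⟨fun _ => Iff.rfl, fun _ => or_comm⟩)
    have l2 := low hex h₂ (Or.inr ⟨fun _ => Iff.rfl, fun _ => Iff.rfl⟩)
    rw [if_neg fun h => absurd ((le_max_right _ _).trans_lt h) (l1.trans_lt g).not_gt,
      if_neg fun h => absurd ((le_max_right _ _).trans_lt h) (l2.trans_lt g).not_gt,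
      if_pos (max_lt (l1.trans_lt g) (l2.trans_lt g)), if_neg c1, if_neg c2]

end TensorRing

end

/-! ### Reading the place of a new index from an exact answer. -/

section

namespace TensorRing

theorem cyclicEquiv_comp_iff {α β : Type} {g : α → β} (hg : Function.Injective g)
    (p p' : Fin 4 → α) : CyclicEquiv (fun s => g (p s)) (fun s => g (p' s)) ↔ CyclicEquiv p p' := by
  simp only [CyclicEquiv, hg.eq_iff]

theorem injective_cons_four {α : Type} {x a b c : α} (hxa : x ≠ a) (hxb : x ≠ b) (hxc : x ≠ c)
    (hab : a ≠ b) (hac : a ≠ c) (hbc : b ≠ c) : Function.Injective ![x, a, b, c] := by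
  intro i j hij
  fin_cases i <;> fin_cases j <;> simp_all [eq_comm]

section Probe

variable {d : ℕ} {ρ : Equiv.Perm (Fin d)} {x a b c : Fin d}

/-- Three probes cut the circle into three arcs, one for each cyclic order. Before `a` and after `c`
are the same arc, so the search has to exclude one of them by other means. -/
theorem cyclicEquiv_exactAnswer_iff (hab : ρ.symm a < ρ.symm b) (hbc : ρ.symm b < ρ.symm c)
    (hxa : x ≠ a) (hxb : x ≠ b) (hxc : x ≠ c) :
    (CyclicEquiv (exactAnswer ρ ![x, a, b, c]) ![a, x, b, c] ↔
      ρ.symm a < ρ.symm x ∧ ρ.symm x < ρ.symm b) ∧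
    (CyclicEquiv (exactAnswer ρ ![x, a, b, c]) ![a, b, x, c] ↔
      ρ.symm b < ρ.symm x ∧ ρ.symm x < ρ.symm c) := by
  have hac := hab.trans hbc
  have hinj : Function.Injective ![x, a, b, c] :=
    injective_cons_four hxa hxb hxc (fun h => by simp [h] at hab) (fun h => by simp [h] at hac)
      fun h => by simp [h] at hbc
  have e : ∀ i j k l : Fin 4, (![![x, a, b, c] i, ![x, a, b, c] j, ![x, a, b, c] k,
      ![x, a, b, c] l] : Fin 4 → Fin d) = fun s => ![x, a, b, c] (![i, j, k, l] s) := by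
    intro i j k l; funext s; fin_cases s <;> rfl
  -- Injectivity moves the comparison to labels in `Fin 4`, where it is decided by computation.
  have hA : ∀ i j k l : Fin 4, CyclicEquiv (![![x, a, b, c] i, ![x, a, b, c] j, ![x, a, b, c] k,
      ![x, a, b, c] l] : Fin 4 → Fin d) ![a, x, b, c] ↔ CyclicEquiv ![i, j, k, l] ![1, 0, 2, 3] := by
    intro i j k l
    rw [e, ← cyclicEquiv_comp_iff hinj, ← e 1 0 2 3]
    rfl
  have hB : ∀ i j k l : Fin 4, CyclicEquiv (![![x, a, b, c] i, ![x, a, b, c] j, ![x, a, b, c] k,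
      ![x, a, b, c] l] : Fin 4 → Fin d) ![a, b, x, c] ↔ CyclicEquiv ![i, j, k, l] ![1, 2, 0, 3] := by
    intro i j k l
    rw [e, ← cyclicEquiv_comp_iff hinj, ← e 1 2 0 3]
    rfl
  have hex := correctOrder_exactAnswer ρ hinj
  unfold exactAnswer at hex ⊢
  split_ifs at hex ⊢ with c1 c2
  · rw [hA, hB]
    rw [show CyclicEquiv ![(0 : Fin 4), 2, 1, 3] ![1, 0, 2, 3] ↔ False by decide,
      show CyclicEquiv ![(0 : Fin 4), 2, 1, 3] ![1, 2, 0, 3] ↔ True by decide]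
    have c1 := (correctOrder_cons_iff _ _ _ _).1 c1
    simp only [Matrix.cons_val] at c1
    rcases c1 with ⟨h1, h2, h3⟩ | ⟨h1, h2, h3⟩ | ⟨h1, h2, h3⟩ | ⟨h1, h2, h3⟩ | ⟨h1, h2, h3⟩ |
      ⟨h1, h2, h3⟩ | ⟨h1, h2, h3⟩ | ⟨h1, h2, h3⟩ <;>
      first
      | (exfalso; order)
      | exact ⟨⟨False.elim, fun ⟨_, _⟩ => by order⟩, ⟨fun _ => ⟨by order, by order⟩, fun _ => trivial⟩⟩
  · rw [hA, hB]
    rw [show CyclicEquiv ![(0 : Fin 4), 1, 2, 3] ![1, 0, 2, 3] ↔ False by decide,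
      show CyclicEquiv ![(0 : Fin 4), 1, 2, 3] ![1, 2, 0, 3] ↔ False by decide]
    have c1 := (correctOrder_cons_iff _ _ _ _).1 c2
    simp only [Matrix.cons_val] at c1
    rcases c1 with ⟨h1, h2, h3⟩ | ⟨h1, h2, h3⟩ | ⟨h1, h2, h3⟩ | ⟨h1, h2, h3⟩ | ⟨h1, h2, h3⟩ |
      ⟨h1, h2, h3⟩ | ⟨h1, h2, h3⟩ | ⟨h1, h2, h3⟩ <;>
      first
      | (exfalso; order)
      | exact ⟨⟨False.elim, fun ⟨_, _⟩ => by order⟩, ⟨False.elim, fun ⟨_, _⟩ => by order⟩⟩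
  · rw [hA, hB]
    rw [show CyclicEquiv ![(0 : Fin 4), 1, 3, 2] ![1, 0, 2, 3] ↔ True by decide,
      show CyclicEquiv ![(0 : Fin 4), 1, 3, 2] ![1, 2, 0, 3] ↔ False by decide]
    have c1 := (correctOrder_cons_iff _ _ _ _).1 hex
    simp only [Matrix.cons_val] at c1
    rcases c1 with ⟨h1, h2, h3⟩ | ⟨h1, h2, h3⟩ | ⟨h1, h2, h3⟩ | ⟨h1, h2, h3⟩ | ⟨h1, h2, h3⟩ |
      ⟨h1, h2, h3⟩ | ⟨h1, h2, h3⟩ | ⟨h1, h2, h3⟩ <;>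
      first
      | (exfalso; order)
      | exact ⟨⟨fun _ => ⟨by order, by order⟩, fun _ => trivial⟩, ⟨False.elim, fun ⟨_, _⟩ => by order⟩⟩

end Probe

end TensorRing

end

/-! ### Query sets of the exact run and correctness of the search. -/

section

namespace TensorRing

/-- The answers are exact on all labelled queries in `Q`. -/
def ExactOn {d : ℕ} (ρ : Equiv.Perm (Fin d)) (Q : Finset ((ℕ × ℕ) × (Fin 4 → Fin d)))
    (ask : ℕ × ℕ → (Fin 4 → Fin d) → Option (Fin 4 → Fin d)) : Prop :=
  ∀ p ∈ Q, ask p.1 p.2 = some (exactAnswer ρ p.2)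

/-- A computation `run` with oracle `ask` makes at most `m` queries, all of them for four different
indices, on the way to the result `out`, if they are answered exactly. -/
def Computes {d : ℕ} {α : Type} (ρ : Equiv.Perm (Fin d)) (m : ℕ)
    (run : (ℕ × ℕ → (Fin 4 → Fin d) → Option (Fin 4 → Fin d)) → Option α) (out : α) : Prop :=
  ∃ Q : Finset ((ℕ × ℕ) × (Fin 4 → Fin d)), Q.card ≤ m ∧ (∀ p ∈ Q, Function.Injective p.2) ∧
    ∀ ask, ExactOn ρ Q ask → run ask = some out

theorem Computes.of_eq {d : ℕ} {α : Type} {ρ : Equiv.Perm (Fin d)} {m : ℕ}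
    {run : (ℕ × ℕ → (Fin 4 → Fin d) → Option (Fin 4 → Fin d)) → Option α} {out : α}
    (h : ∀ ask, run ask = some out) : Computes ρ m run out :=
  ⟨∅, by simp, by simp, fun ask _ => h ask⟩

/-- Only the continuation after the exact intermediate result is charged: counts add along the exact
run, not over the whole decision tree. -/
theorem Computes.bind {d : ℕ} {α β : Type} {ρ : Equiv.Perm (Fin d)} {m m' : ℕ}
    {run : (ℕ × ℕ → (Fin 4 → Fin d) → Option (Fin 4 → Fin d)) → Option α} {out : α}
    {run' : (ℕ × ℕ → (Fin 4 → Fin d) → Option (Fin 4 → Fin d)) → α → Option β} {out' : β}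
    (h : Computes ρ m run out) (h' : Computes ρ m' (fun ask => run' ask out) out') :
    Computes ρ (m + m') (fun ask => (run ask).bind (run' ask)) out' := by
  classical
  obtain ⟨Q, hQ, hQi, hQr⟩ := h
  obtain ⟨Q', hQ', hQi', hQr'⟩ := h'
  refine ⟨Q ∪ Q', (Finset.card_union_le _ _).trans (add_le_add hQ hQ'), fun p hp => ?_,
    fun ask hask => ?_⟩
  · rcases Finset.mem_union.1 hp with h | h
    · exact hQi p h
    · exact hQi' p h
  · dsimp only
    rw [hQr ask fun p hp => hask p (Finset.mem_union_left _ hp), Option.bind_some]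
    exact hQr' ask fun p hp => hask p (Finset.mem_union_right _ hp)

theorem Computes.ask {d : ℕ} {ρ : Equiv.Perm (Fin d)} (c : ℕ × ℕ) {q : Fin 4 → Fin d}
    (hq : Function.Injective q) : Computes ρ 1 (fun ask => ask c q) (exactAnswer ρ q) :=
  ⟨{(c, q)}, by simp, by simpa using hq, fun ask h => h _ (Finset.mem_singleton_self _)⟩

theorem Computes.mono {d : ℕ} {α : Type} {ρ : Equiv.Perm (Fin d)} {m m' : ℕ}
    {run : (ℕ × ℕ → (Fin 4 → Fin d) → Option (Fin 4 → Fin d)) → Option α} {out : α}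
    (h : Computes ρ m run out) (hm : m ≤ m') : Computes ρ m' run out := by
  obtain ⟨Q, hQ, h⟩ := h
  exact ⟨Q, hQ.trans hm, h⟩

/-- The probes, and how far each of the three possible answers narrows the search. -/
theorem probes_spec {t jmin jmax m k : ℕ} (h1 : 1 ≤ jmin) (h2 : jmin ≤ k) (h3 : k < jmax)
    (h4 : jmax ≤ t + 1) (ht : 3 ≤ t) (hD : 2 ≤ jmax - jmin) (hm : jmax - jmin ≤ 2 ^ (m + 1)) :
    ∃ j₁ j₂ j₃, probes t jmin jmax = (j₁, j₂, j₃) ∧ 1 ≤ j₁ ∧ j₁ < j₂ ∧ j₂ < j₃ ∧ j₃ ≤ t ∧ j₁ ≤ k ∧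
      (k < j₂ → j₂ - j₁ ≤ 2 ^ m) ∧ (j₂ ≤ k → k < j₃ → j₃ - j₂ ≤ 2 ^ m) ∧
      (j₃ ≤ k → jmax - j₃ ≤ 2 ^ m) := by
  have hM : 1 ≤ 2 ^ m := Nat.one_le_two_pow
  rw [pow_succ] at hm
  unfold probes
  split_ifs with c1 c2
  · refine ⟨_, _, _, rfl, ?_⟩
    omega
  · refine ⟨_, _, _, rfl, ?_⟩
    omega
  · refine ⟨_, _, _, rfl, ?_⟩
    omega

/-- Here `k` counts the entries before `x`, and `jmin ≤ k < jmax` is invariant. A pass brings the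
bound on the gap from `2 ^ (m + 1)` down to `2 ^ m`. Since the first probe is at most `k`, the arc
beyond the third probe can only mean a place after it. -/
theorem computes_searchLoop {d : ℕ} {ρ : Equiv.Perm (Fin d)} {x : Fin d} {l : List (Fin d)}
    {t k : ℕ} (hl : l.length = t) (ht : 3 ≤ t) (hx : x ∉ l)
    (hsort : l.Pairwise fun a b => ρ.symm a < ρ.symm b)
    (hk : ∀ (i : ℕ) (hi : i < l.length), ρ.symm l[i] < ρ.symm x ↔ i < k) (m : ℕ) :
    ∀ passes s jmin jmax, m ≤ passes → 1 ≤ jmin → jmin ≤ k → k < jmax → jmax ≤ t + 1 →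
      jmax - jmin ≤ 2 ^ m →
      Computes ρ m (fun ask => searchLoop ask t x l passes s jmin jmax) (k, k + 1) := by
  have halt : ∀ passes s jmin jmax, jmin ≤ k → k < jmax → ¬ 2 ≤ jmax - jmin → ∀ m,
      Computes ρ m (fun ask => searchLoop ask t x l passes s jmin jmax) (k, k + 1) := by
    intro passes s jmin jmax h2 h3 hD m
    refine Computes.of_eq fun ask => ?_
    obtain rfl : jmin = k := by omega
    obtain rfl : jmax = jmin + 1 := by omega
    cases passes <;> rw [searchLoop, if_neg hD]
  induction m with
  | zero =>
    intro passes s jmin jmax _ _ h2 h3 _ hm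
    exact halt _ _ _ _ h2 h3 (by rw [pow_zero] at hm; omega) _
  | succ m ih =>
    intro passes s jmin jmax hp h1 h2 h3 h4 hm
    by_cases hD : 2 ≤ jmax - jmin
    swap
    · exact halt _ _ _ _ h2 h3 hD _
    obtain ⟨passes, rfl⟩ : ∃ p, passes = p + 1 := ⟨passes - 1, by omega⟩
    obtain ⟨j₁, j₂, j₃, hj, g1, g2, g3, g4, g5, n1, n2, n3⟩ :=
      probes_spec h1 h2 h3 h4 ht hD hm
    have b1 : j₁ - 1 < l.length := by omega
    have b2 : j₂ - 1 < l.length := by omega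
    have b3 : j₃ - 1 < l.length := by omega
    have hlt : ∀ (i j : ℕ) (hi : i < l.length) (hj : j < l.length), i < j →
        ρ.symm l[i] < ρ.symm l[j] := fun i j hi hj hij => List.pairwise_iff_getElem.1 hsort i j hi hj hij
    have hne : ∀ (i : ℕ) (hi : i < l.length), x ≠ l[i] := fun i hi h =>
      hx (h ▸ List.getElem_mem hi)
    have hab := hlt (j₁ - 1) (j₂ - 1) b1 b2 (by omega)
    have hbc := hlt (j₂ - 1) (j₃ - 1) b2 b3 (by omega)
    have hq : Function.Injective ![x, l[j₁ - 1], l[j₂ - 1], l[j₃ - 1]] :=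
      injective_cons_four (hne _ _) (hne _ _) (hne _ _)
        (fun h => by rw [h] at hab; exact lt_irrefl _ hab)
        (fun h => by have := hab.trans hbc; rw [h] at this; exact lt_irrefl _ this)
        (fun h => by rw [h] at hbc; exact lt_irrefl _ hbc)
    obtain ⟨hA, hB⟩ := cyclicEquiv_exactAnswer_iff hab hbc (hne _ _) (hne _ _) (hne _ _)
    have hgt : ∀ (i : ℕ) (hi : i < l.length), ρ.symm x < ρ.symm l[i] ↔ ¬ i < k := by
      intro i hi
      rw [← hk i hi, not_lt]
      exact ⟨le_of_lt, fun h => h.lt_of_ne fun h => hne i hi (by simpa using h)⟩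
    rw [hk _ b1, hgt _ b2] at hA
    rw [hk _ b2, hgt _ b3] at hB
    have hrun : (fun ask => searchLoop ask t x l (passes + 1) s jmin jmax) = fun ask =>
        (ask (t, s) ![x, l[j₁ - 1], l[j₂ - 1], l[j₃ - 1]]).bind fun out =>
          if CyclicEquiv out ![l[j₁ - 1], x, l[j₂ - 1], l[j₃ - 1]] then
            searchLoop ask t x l passes (s + 1) j₁ j₂
          else if CyclicEquiv out ![l[j₁ - 1], l[j₂ - 1], x, l[j₃ - 1]] then
            searchLoop ask t x l passes (s + 1) j₂ j₃
          else searchLoop ask t x l passes (s + 1) j₃ jmax := by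
      funext ask
      rw [searchLoop, if_pos hD]
      simp only [hj, List.getElem?_eq_getElem b1, List.getElem?_eq_getElem b2,
        List.getElem?_eq_getElem b3]
      rfl
    rw [hrun, add_comm m 1]
    refine Computes.bind (Computes.ask (t, s) hq) ?_
    by_cases k2 : k < j₂
    · simp only [if_pos (hA.2 (by omega))]
      exact ih _ _ _ _ (by omega) g1 g5 k2 (by omega) (n1 k2)
    · simp only [if_neg fun h => k2 (by have := hA.1 h; omega)]
      by_cases k3 : k < j₃
      · simp only [if_pos (hB.2 (by omega))]
        exact ih _ _ _ _ (by omega) (by omega) (by omega) k3 (by omega) (n2 (by omega) k3)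
      · simp only [if_neg fun h => k3 (by have := hB.1 h; omega)]
        exact ih _ _ _ _ (by omega) (by omega) (by omega) h3 h4 (n3 (by omega))

/-- A list of the first `t` indices, in the order given by `ρ` and with the first position. -/
structure IsOrdered {d : ℕ} (ρ : Equiv.Perm (Fin d)) (t : ℕ) (l : List (Fin d)) : Prop where
  length_eq : l.length = t
  mem_iff : ∀ x : Fin d, x ∈ l ↔ (x : ℕ) < t
  sorted : l.Pairwise fun a b => ρ.symm a < ρ.symm b
  first_mem : ∃ a ∈ l, (ρ.symm a : ℕ) = 0

theorem exists_split {d : ℕ} (ρ : Equiv.Perm (Fin d)) (x : Fin d) (l : List (Fin d))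
    (h : l.Pairwise fun a b => ρ.symm a < ρ.symm b) (hx : x ∉ l) :
    ∃ l₁ l₂, l = l₁ ++ l₂ ∧ (∀ a ∈ l₁, ρ.symm a < ρ.symm x) ∧ ∀ a ∈ l₂, ρ.symm x < ρ.symm a := by
  induction l with
  | nil => exact ⟨[], [], rfl, by simp, by simp⟩
  | cons b l ih =>
    rw [List.pairwise_cons] at h
    rw [List.mem_cons, not_or] at hx
    obtain ⟨l₁, l₂, rfl, h1, h2⟩ := ih h.2 hx.2
    rcases lt_or_gt_of_ne (fun h => hx.1 (ρ.symm.injective h) : ρ.symm x ≠ ρ.symm b) with hb | hb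
    · refine ⟨[], b :: (l₁ ++ l₂), rfl, by simp, fun a ha => ?_⟩
      rcases List.mem_cons.1 ha with rfl | ha
      · exact hb
      · exact hb.trans (h.1 a ha)
    · refine ⟨b :: l₁, l₂, rfl, fun a ha => ?_, h2⟩
      rcases List.mem_cons.1 ha with rfl | ha
      · exact hb
      · exact h1 a ha

theorem computes_insertNext {d : ℕ} {ρ : Equiv.Perm (Fin d)} {l : List (Fin d)} {x : Fin d}
    (hl : IsOrdered ρ x l) (hx : 3 ≤ (x : ℕ)) :
    ∃ l', IsOrdered ρ (x + 1) l' ∧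
      Computes ρ (Nat.clog 2 d) (fun ask => insertNext ask l x) l' := by
  have hxl : x ∉ l := fun h => lt_irrefl _ ((hl.mem_iff x).1 h)
  obtain ⟨l₁, l₂, hll, h1, h2⟩ := exists_split ρ x l hl.sorted hxl
  have hlen := hl.length_eq
  have hlen' : l₁.length + l₂.length = x := by rw [← hlen, hll, List.length_append]
  obtain ⟨a, ha, ha0⟩ := hl.first_mem
  -- The index at position zero is already in the list, so `x` never precedes it; this starts the
  -- search with `1 ≤ k`.
  have ha1 : a ∈ l₁ := by
    rw [hll, List.mem_append] at ha
    refine ha.resolve_right fun h => ?_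
    have := h2 a h
    rw [Fin.lt_def] at this
    omega
  have hk1 : 1 ≤ l₁.length := List.length_pos_of_mem ha1
  refine ⟨l₁ ++ [x] ++ l₂, ⟨?_, fun y => ?_, ?_, a, by simp [ha1], ha0⟩, ?_⟩
  · simp only [List.length_append, List.length_singleton]; omega
  · have := hl.mem_iff y
    rw [hll, List.mem_append] at this
    simp only [List.mem_append, List.mem_singleton]
    rw [or_right_comm, this, Fin.ext_iff]
    omega
  · have hs := hl.sorted
    rw [hll, List.pairwise_append] at hs
    simp only [List.pairwise_append, List.mem_append, List.mem_singleton, List.pairwise_singleton,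
      true_and]
    refine ⟨⟨hs.1, ?_⟩, hs.2.1, ?_⟩
    · rintro b hb c rfl; exact h1 b hb
    · rintro b (hb | rfl) c hc
      · exact hs.2.2 b hb c hc
      · exact h2 c hc
  · have hk : ∀ (i : ℕ) (hi : i < l.length), ρ.symm l[i] < ρ.symm x ↔ i < l₁.length := by
      intro i hi
      subst hll
      rw [List.getElem_append]
      split_ifs with h
      · exact iff_of_true (h1 _ (List.getElem_mem _)) h
      · exact iff_of_false (h2 _ (List.getElem_mem _)).not_gt h
    -- The initial gap is `x ≤ 2 ^ clog 2 x`, and `clog 2 x ≤ x` stays within the bound of `2 * x`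
    -- passes.
    have hsearch := (computes_searchLoop (ρ := ρ) hlen hx hxl hl.sorted hk (Nat.clog 2 x)
      (2 * x) 0 1 (x + 1) (by
        have := Nat.clog_le_of_le_pow (b := 2) (Nat.lt_two_pow_self (n := (x : ℕ))).le
        omega) le_rfl hk1 (by omega) le_rfl (by
        rw [Nat.add_sub_cancel]; exact Nat.le_pow_clog one_lt_two _)).mono
        (Nat.clog_mono_right 2 x.isLt.le)
    have := hsearch.bind (m' := 0)
      (run' := fun _ j => some (l.take j.1 ++ [x] ++ l.drop (j.2 - 1)))
      (out' := l₁ ++ [x] ++ l₂) (Computes.of_eq fun _ => by simp [hll])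
    exact this

theorem computes_foldlM {d : ℕ} {ρ : Equiv.Perm (Fin d)} (m : ℕ) :
    ∀ (t : ℕ) (l : List (Fin d)), t + m = d → 3 ≤ t → IsOrdered ρ t l →
      ∃ l', IsOrdered ρ d l' ∧ Computes ρ (m * Nat.clog 2 d)
        (fun ask => ((List.finRange d).drop t).foldlM (insertNext ask) l) l' := by
  induction m with
  | zero =>
    intro t l ht _ hl
    obtain rfl : t = d := by omega
    refine ⟨l, hl, Computes.of_eq fun ask => ?_⟩
    rw [List.drop_of_length_le (by simp)]
    rfl
  | succ m ih =>
    intro t l ht h3 hl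
    have htd : t < d := by omega
    obtain ⟨l₁, hl₁, hc₁⟩ := computes_insertNext (x := ⟨t, htd⟩) hl h3
    obtain ⟨l', hl', hc'⟩ := ih (t + 1) l₁ (by omega) (by omega) hl₁
    refine ⟨l', hl', ?_⟩
    have := hc₁.bind (run' := fun ask l => ((List.finRange d).drop (t + 1)).foldlM (insertNext ask) l)
      hc'
    rw [Nat.succ_mul, add_comm (m * _)]
    have hdrop : (List.finRange d).drop t = ⟨t, htd⟩ :: (List.finRange d).drop (t + 1) := by
      rw [List.drop_eq_getElem_cons (by simpa using htd), List.getElem_finRange]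
      rfl
    simp only [hdrop, List.foldlM_cons]
    exact this

theorem IsOrdered.eq_ofFn {d : ℕ} {ρ : Equiv.Perm (Fin d)} {l : List (Fin d)}
    (hl : IsOrdered ρ d l) : l = List.ofFn ρ := by
  have h : l.map ρ.symm = List.finRange d := by
    refine List.Perm.eq_of_pairwise (le := (· < ·)) (fun a b _ _ h1 h2 => absurd h1 h2.not_gt) ?_ ?_ ?_
    · exact List.pairwise_map.2 hl.sorted
    · exact List.pairwise_lt_finRange d
    · refine (List.perm_ext_iff_of_nodup ?_ (List.nodup_finRange d)).2 fun a => ?_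
      · exact (List.pairwise_map.2 hl.sorted).imp fun h => h.ne
      · simp only [List.mem_finRange, iff_true, List.mem_map]
        exact ⟨ρ a, (hl.mem_iff _).2 (ρ a).isLt, by simp⟩
  rw [List.ofFn_eq_map, ← h, List.map_map]
  simp

end TensorRing

end

/-! ### Normalizing the ring and the complete noiseless run. -/

section

namespace TensorRing

theorem val_finRotate_pow {d : ℕ} (k : ℕ) (i : Fin d) :
    ((finRotate d ^ k) i : ℕ) = (i + k) % d := by
  induction k with
  | zero => simp [Nat.mod_eq_of_lt i.isLt]
  | succ k ih =>
    rw [pow_succ', Equiv.Perm.mul_apply, val_finRotate, ih, ← add_assoc]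
    have hd : 0 < d := i.pos
    have h1 := Nat.mod_lt ((i : ℕ) + k) hd
    rw [Nat.add_mod_eq_ite (m := (i : ℕ) + k) (n := 1)]
    rcases Nat.lt_or_ge 1 d with h | h
    · rw [Nat.mod_eq_of_lt h]
      split_ifs <;> omega
    · obtain rfl : d = 1 := by omega
      simp [Nat.mod_one]

theorem finRotate_pow_self (d : ℕ) : finRotate d ^ d = 1 := by
  ext i
  rw [val_finRotate_pow, Nat.add_mod_right, Nat.mod_eq_of_lt i.isLt]
  rfl

/-- Four indices in correct order are increasing from the first position for a suitable
description of the same ring. -/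
theorem CorrectOrder.exists_sameRing {d : ℕ} {τ : Equiv.Perm (Fin d)} {o : Fin 4 → Fin d}
    (h : CorrectOrder τ o) :
    ∃ ρ, SameRing τ ρ ∧ (ρ.symm (o 0) : ℕ) = 0 ∧ ρ.symm (o 0) < ρ.symm (o 1) ∧
      ρ.symm (o 1) < ρ.symm (o 2) ∧ ρ.symm (o 2) < ρ.symm (o 3) := by
  set k : ℕ := (τ.symm (o 0) : ℕ) with hk
  have hkd : k < d := (τ.symm (o 0)).isLt
  have hd : 0 < d := by omega
  set ρ : Equiv.Perm (Fin d) := τ * finRotate d ^ k with hρ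
  have hsame : SameRing τ ρ := ⟨k, hkd, 0, by norm_num, by rw [pow_zero, mul_one]⟩
  have h0 : (ρ.symm (o 0) : ℕ) = 0 := by
    have : ρ ⟨0, hd⟩ = o 0 := by
      rw [hρ, Equiv.Perm.mul_apply, ← Equiv.eq_symm_apply]
      ext
      rw [val_finRotate_pow, Nat.zero_add, Nat.mod_eq_of_lt hkd]
    rw [← this, Equiv.symm_apply_apply]
  obtain ⟨s, hs⟩ := (hsame.correctOrder_iff o).1 h
  -- With `o 0` rotated to position zero, only two of the eight linear orders survive.
  have cases : (ρ.symm (o 0) < ρ.symm (o 1) ∧ ρ.symm (o 1) < ρ.symm (o 2) ∧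
      ρ.symm (o 2) < ρ.symm (o 3)) ∨ (ρ.symm (o 0) < ρ.symm (o 3) ∧
      ρ.symm (o 3) < ρ.symm (o 2) ∧ ρ.symm (o 2) < ρ.symm (o 1)) := by
    fin_cases s <;> simp only [Fin.isValue, Fin.mk_one, Fin.zero_eta, Fin.reduceFinMk,
      Fin.reduceAdd, gt_iff_lt, zero_add, Fin.lt_def] at hs ⊢ <;> omega
  rcases cases with hc | hc
  · exact ⟨ρ, hsame, h0, hc⟩
  -- Reflection followed by a rotation fixes position zero and sends `j` to `d - j`, which reverses
  -- the other three. The rotation exponent `k + 1` may reach `d`, and is then replaced by zero.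
  set ρ' : Equiv.Perm (Fin d) := ρ * (finRotate d * Fin.revPerm) with hρ'
  have hsame' : SameRing τ ρ' := by
    have e : ρ' = τ * finRotate d ^ (k + 1) * Fin.revPerm ^ 1 := by
      rw [hρ', hρ, pow_succ, pow_one]; simp only [mul_assoc]
    rcases Nat.lt_or_ge (k + 1) d with h | h
    · exact ⟨k + 1, h, 1, by norm_num, e⟩
    · refine ⟨0, hd, 1, by norm_num, ?_⟩
      rw [e, show k + 1 = d by omega, finRotate_pow_self, pow_zero]
  have hval : ∀ x, (ρ.symm x : ℕ) = if (ρ'.symm x : ℕ) = 0 then 0 else d - (ρ'.symm x : ℕ) := by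
    intro x
    have : ρ.symm x = finRotate d (ρ'.symm x).rev := by
      rw [Equiv.symm_apply_eq, ← Fin.revPerm_apply, ← Equiv.Perm.mul_apply, ← Equiv.Perm.mul_apply,
        mul_assoc, ← hρ', Equiv.apply_symm_apply]
    have hb := (ρ'.symm x).isLt
    rw [this, val_finRotate, Fin.val_rev]
    split_ifs <;> omega
  refine ⟨ρ', hsame', ?_⟩
  have e0 := hval (o 0)
  have e1 := hval (o 1)
  have e2 := hval (o 2)
  have e3 := hval (o 3)
  have b0 := (ρ'.symm (o 0)).isLt
  simp only [Fin.lt_def] at hc ⊢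
  split_ifs at e0 e1 e2 e3 <;> omega

theorem mem_exactAnswer_iff {d : ℕ} {τ : Equiv.Perm (Fin d)} (q : Fin 4 → Fin d) (x : Fin d) :
    x ∈ List.ofFn (exactAnswer τ q) ↔ ∃ s, q s = x := by
  rw [List.mem_ofFn]
  simp only [Fin.exists_fin_succ, exactAnswer]
  split_ifs <;> simp <;> tauto

/-- Without errors, the algorithm describes the right ring, after `O(d log d)` queries. -/
theorem computes_recoverRing {d : ℕ} (hd : 4 ≤ d) (τ : Equiv.Perm (Fin d)) :
    ∃ τ', SameRing τ τ' ∧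
      Computes τ (1 + (d - 4) * Nat.clog 2 d) (recoverRing hd) (List.ofFn τ') := by
  set q : Fin 4 → Fin d := fun s => Fin.castLE hd s with hq
  have hqi : Function.Injective q := Fin.castLE_injective hd
  obtain ⟨ρ, hρ, h0, h1, h2, h3⟩ := (correctOrder_exactAnswer τ hqi).exists_sameRing
  have hord : IsOrdered ρ 4 (List.ofFn (exactAnswer τ q)) := by
    refine ⟨by simp, fun x => ?_, ?_, exactAnswer τ q 0, by simp, h0⟩
    · rw [mem_exactAnswer_iff]
      constructor
      · rintro ⟨s, rfl⟩
        exact s.isLt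
      · exact fun hx => ⟨⟨x, hx⟩, rfl⟩
    · simp only [List.ofFn_succ, List.ofFn_zero, List.pairwise_cons]
      refine ⟨?_, ?_, ?_, ?_, List.Pairwise.nil⟩
      all_goals
        simp only [List.mem_cons, List.not_mem_nil, or_false, Fin.isValue, Fin.succ_zero_eq_one,
          Fin.succ_one_eq_two, forall_eq_or_imp, forall_eq, IsEmpty.forall_iff, implies_true]
      · exact ⟨h1, h1.trans h2, (h1.trans h2).trans h3⟩
      · exact ⟨h2, h2.trans h3⟩
      · exact h3
  obtain ⟨l, hl, hc⟩ := computes_foldlM (d - 4) 4 _ (by omega) (by norm_num) hord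
  refine ⟨ρ, hρ, ?_⟩
  -- The search is analysed for the normalized `ρ`; its exact answers are those of `τ`.
  have hc' : Computes τ ((d - 4) * Nat.clog 2 d)
      (fun ask => ((List.finRange d).drop 4).foldlM (insertNext ask)
        (List.ofFn (exactAnswer τ q))) l := by
    obtain ⟨Q, hQ, hQi, hrun⟩ := hc
    refine ⟨Q, hQ, hQi, fun ask hask => hrun ask fun p hp => ?_⟩
    rw [hask p hp, hρ.exactAnswer_eq]
  rw [← hl.eq_ofFn]
  exact (Computes.ask (0, 0) hqi).bind
    (run' := fun ask q => ((List.finRange d).drop 4).foldlM (insertNext ask) (List.ofFn q)) hc'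

end TensorRing

end

/-! ### Failure probability of a single call and the number of calls. -/

section

open MeasureTheory ProbabilityTheory

namespace TensorRing

theorem law_div_of_iIndepFun_gaussianReal {Ω : Type*} [MeasurableSpace Ω] {P : Measure Ω}
    [IsProbabilityMeasure P] {ι J : Type*} [Fintype J] {σe : ℝ} (hσe : 0 < σe) {E : ι → Ω → ℝ}
    (hlaw : ∀ x, HasLaw (E x) (gaussianReal 0 (σe ^ 2).toNNReal) P) (hind : iIndepFun E P)
    {φ : J → ι} (hφ : Function.Injective φ) :
    AEMeasurable (fun ω j => E (φ j) ω / σe) P ∧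
      P.map (fun ω j => E (φ j) ω / σe) = gaussianPi J := by
  have hlaw' : ∀ j, HasLaw (fun ω => E (φ j) ω / σe) (gaussianReal 0 1) P := by
    intro j
    have h := gaussianReal_div_const (hlaw (φ j)) σe
    rw [zero_div] at h
    convert! h using 2
    refine NNReal.eq ?_
    rw [NNReal.coe_div, Real.coe_toNNReal _ (sq_nonneg σe)]
    exact (div_self (pow_ne_zero 2 hσe.ne')).symm
  have hae : ∀ j, AEMeasurable (fun ω => E (φ j) ω / σe) P := fun j => (hlaw' j).aemeasurable
  have hind' : iIndepFun (fun j ω => E (φ j) ω / σe) P :=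
    (hind.precomp hφ).comp (fun _ x => x / σe) fun _ => by fun_prop
  refine ⟨aemeasurable_pi_lambda _ hae, ?_⟩
  rw [(iIndepFun_iff_map_fun_eq_pi_map hae).1 hind']
  congr 1
  funext j
  exact (hlaw' j).map_eq

/-- The entry of the tensor at a given place of the matricization. -/
def matricizationIndex {d : ℕ} {n : Fin d → ℕ} (y : ∀ i, Fin (n i)) (a b c e : Fin d)
    (p : (Fin (n a) × Fin (n b)) × (Fin (n c) × Fin (n e))) : ∀ i, Fin (n i) :=
  Function.update (Function.update (Function.update (Function.update y a p.1.1) b p.1.2) c p.2.1)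
    e p.2.2

/-- Different places of the matrix carry different, hence independent, noise variables. -/
theorem matricizationIndex_injective {d : ℕ} {n : Fin d → ℕ} (y : ∀ i, Fin (n i)) {a b c e : Fin d}
    (hq : Function.Injective ![a, b, c, e]) :
    Function.Injective (matricizationIndex y a b c e) := by
  have hab : a ≠ b := hq.ne (a₁ := 0) (a₂ := 1) (by decide)
  have hac : a ≠ c := hq.ne (a₁ := 0) (a₂ := 2) (by decide)
  have hae : a ≠ e := hq.ne (a₁ := 0) (a₂ := 3) (by decide)
  have hbc : b ≠ c := hq.ne (a₁ := 1) (a₂ := 2) (by decide)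
  have hbe : b ≠ e := hq.ne (a₁ := 1) (a₂ := 3) (by decide)
  have hce : c ≠ e := hq.ne (a₁ := 2) (a₂ := 3) (by decide)
  rintro ⟨⟨p1, p2⟩, p3, p4⟩ ⟨⟨q1, q2⟩, q3, q4⟩ h
  have h1 := congrFun h a
  have h2 := congrFun h b
  have h3 := congrFun h c
  have h4 := congrFun h e
  simp only [matricizationIndex, Function.update_self, Function.update_of_ne, ne_eq, hab, hac, hae,
    hbc, hbe, hce, not_false_eq_true] at h1 h2 h3 h4
  rw [h1, h2, h3, h4]

theorem sqrt_card_prod_le {k l m : ℕ} (hk : k ≤ m) (hl : l ≤ m) :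
    √(Fintype.card (Fin k × Fin l)) ≤ m := by
  rw [Real.sqrt_le_left (by positivity), Fintype.card_prod, Fintype.card_fin, Fintype.card_fin]
  have : k * l ≤ m ^ 2 := by rw [pow_two]; exact Nat.mul_le_mul hk hl
  exact_mod_cast this

section Noise

variable {d : ℕ} {n : Fin d → ℕ} {Ω : Type*} [MeasurableSpace Ω] {P : Measure Ω}
  [IsProbabilityMeasure P] {σe : ℝ} {E : (∀ i, Fin (n i)) → Ω → ℝ}

theorem prob_not_smallNoise_le (hσe : 0 < σe)
    (hlaw : ∀ x, HasLaw (E x) (gaussianReal 0 (σe ^ 2).toNNReal) P) (hind : iIndepFun E P)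
    (y : ∀ i, Fin (n i)) {m : ℕ} (hm : ∀ i, n i ≤ m) {t : ℝ} (ht : 0 < t) {a b c e : Fin d}
    (hq : Function.Injective ![a, b, c, e]) :
    P.real {ω | ¬ SmallNoise (fun x => E x ω) y (σe * (2 * m + t)) a b c e} ≤
      Real.exp (-(t ^ 2 / 2)) := by
  obtain ⟨hae, hmap⟩ := law_div_of_iIndepFun_gaussianReal hσe hlaw hind
    (matricizationIndex_injective y hq)
  have : Nonempty (Fin (n a) × Fin (n b)) := ⟨(y a, y b)⟩
  have : Nonempty (Fin (n c) × Fin (n e)) := ⟨(y c, y e)⟩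
  refine le_trans ?_ (gaussianPi_opNorm_gt_le (ι := Fin (n a) × Fin (n b))
    (κ := Fin (n c) × Fin (n e)) ht)
  rw [← hmap]
  set B : Set ((Fin (n a) × Fin (n b)) × (Fin (n c) × Fin (n e)) → ℝ) := {G | ∃ v : EuclideanSpace ℝ (Fin (n c) × Fin (n e)),
    (√(Fintype.card (Fin (n a) × Fin (n b))) + √(Fintype.card (Fin (n c) × Fin (n e))) + t) * ‖v‖ <
        ‖Matrix.toEuclideanLin (Matrix.of fun i j => G (i, j)) v‖} with hB
  have hsub : {ω | ¬ SmallNoise (fun x => E x ω) y (σe * (2 * m + t)) a b c e} ⊆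
      (fun ω j => E (matricizationIndex y a b c e j) ω / σe) ⁻¹' B := by
    intro ω hω
    simp only [SmallNoise, not_forall, not_le] at hω
    obtain ⟨v, hv⟩ := hω
    refine ⟨v, ?_⟩
    have h1 := sqrt_card_prod_le (hm a) (hm b)
    have h2 := sqrt_card_prod_le (hm c) (hm e)
    have hmat : matricization (fun x => E x ω) y a b c e =
        σe • Matrix.of fun i j => E (matricizationIndex y a b c e (i, j)) ω / σe := by
      ext i j
      simp only [Matrix.smul_apply, Matrix.of_apply, smul_eq_mul]
      rw [mul_div_cancel₀ _ hσe.ne']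
      rfl
    have hv' : σe * (2 * m + t) * ‖v‖ < ‖σe • Matrix.toEuclideanLin (Matrix.of fun i j =>
        E (matricizationIndex y a b c e (i, j)) ω / σe) v‖ := by
      have := hv
      rwa [hmat, map_smul, LinearMap.smul_apply] at this
    rw [norm_smul, Real.norm_of_nonneg hσe.le, mul_assoc, mul_lt_mul_iff_right₀ hσe] at hv'
    refine lt_of_le_of_lt (mul_le_mul_of_nonneg_right ?_ (norm_nonneg _)) hv'
    linarith
  -- This direction of the pushforward formula holds for arbitrary sets, so `B` need not be
  -- measurable.
  have hle := (measure_mono hsub).trans (Measure.le_map_apply (μ := P) hae B)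
  exact ENNReal.toReal_mono (measure_ne_top _ _) hle

theorem measurableSet_smallNoise (y : ∀ i, Fin (n i)) (s : ℝ) (a b c e : Fin d) :
    MeasurableSet {X : Tensor n | SmallNoise X y s a b c e} := by
  refine IsClosed.measurableSet ?_
  simp only [SmallNoise, Set.ofPred_forall]
  refine isClosed_iInter fun v => isClosed_le ?_ continuous_const
  have hM : Continuous fun X : Tensor n => matricization X y a b c e :=
    continuous_matrix fun i j => continuous_apply _
  refine continuous_norm.comp ?_
  simp only [Matrix.toLpLin_apply]
  exact (PiLp.continuous_toLp 2 _).comp (hM.matrix_mulVec continuous_const)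

/-- The failure probability of one call of the algorithm for four indices. -/
theorem prob_orderFour_ne_le {r : Fin d → ℕ} {τ : Equiv.Perm (Fin d)} {u : Cores n r τ} {R : ℕ}
    {σ : ℝ} (hR : AdmissibleRank n r R) (hσ : UniformGap u R σ) (hσe : 0 < σe)
    (hlaw : ∀ x, HasLaw (E x) (gaussianReal 0 (σe ^ 2).toNNReal) P) (hind : iIndepFun E P)
    {y : Ω → ∀ i, Fin (n i)} (hy : Measurable y) (hyE : IndepFun y (fun ω x => E x ω) P)
    {m : ℕ} (hm : ∀ i, n i ≤ m) {t : ℝ} (ht : 0 < t) (hs : 2 * (σe * (2 * m + t)) < σ)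
    {q : Fin 4 → Fin d} (hq : Function.Injective q) :
    P.real {ω | orderFour R (ringTensor u + fun x => E x ω) (y ω) q ≠ some (exactAnswer τ q)} ≤
      3 * Real.exp (-(t ^ 2 / 2)) := by
  set s := σe * (2 * m + t) with hsdef
  have hs0 : 0 ≤ s := by positivity
  let B : (∀ i, Fin (n i)) → Set (Tensor n) := fun z =>
    {X | SmallNoise X z s (q 0) (q 1) (q 2) (q 3)}ᶜ ∪
      ({X | SmallNoise X z s (q 0) (q 2) (q 1) (q 3)}ᶜ ∪
        {X | SmallNoise X z s (q 0) (q 3) (q 1) (q 2)}ᶜ)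
  have hBm : ∀ z, MeasurableSet (B z) := fun z =>
    (measurableSet_smallNoise _ _ _ _ _ _).compl.union
      ((measurableSet_smallNoise _ _ _ _ _ _).compl.union
        (measurableSet_smallNoise _ _ _ _ _ _).compl)
  have hinj : ∀ i j k l : Fin 4, Function.Injective ![i, j, k, l] →
      Function.Injective ![q i, q j, q k, q l] := by
    intro i j k l h
    have : ![q i, q j, q k, q l] = q ∘ ![i, j, k, l] := by
      funext s; fin_cases s <;> rfl
    rw [this]
    exact hq.comp h
  have hB : ∀ z, P.real ((fun ω x => E x ω) ⁻¹' B z) ≤ 3 * Real.exp (-(t ^ 2 / 2)) := by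
    intro z
    have b1 := prob_not_smallNoise_le hσe hlaw hind z hm ht (hinj 0 1 2 3 (by decide))
    have b2 := prob_not_smallNoise_le hσe hlaw hind z hm ht (hinj 0 2 1 3 (by decide))
    have b3 := prob_not_smallNoise_le hσe hlaw hind z hm ht (hinj 0 3 1 2 (by decide))
    have hu := (measureReal_union_le (μ := P)
      {ω | ¬ SmallNoise (fun x => E x ω) z s (q 0) (q 1) (q 2) (q 3)}
      ({ω | ¬ SmallNoise (fun x => E x ω) z s (q 0) (q 2) (q 1) (q 3)} ∪
        {ω | ¬ SmallNoise (fun x => E x ω) z s (q 0) (q 3) (q 1) (q 2)})).trans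
      (add_le_add_right (measureReal_union_le _ _) _)
    refine hu.trans ?_
    linarith
  -- The sample takes finitely many values and is independent of the noise. For each fixed value the
  -- three matricizations give the bound, and the weights of the values sum to one.
  have hsub : {ω | orderFour R (ringTensor u + fun x => E x ω) (y ω) q ≠ some (exactAnswer τ q)} ⊆
      ⋃ z ∈ (Finset.univ : Finset (∀ i, Fin (n i))), y ⁻¹' {z} ∩ (fun ω x => E x ω) ⁻¹' B z := by
    intro ω hω
    simp only [Finset.mem_univ, Set.iUnion_true, Set.mem_iUnion]
    refine ⟨y ω, rfl, ?_⟩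
    by_contra hB'
    simp only [B, Set.mem_preimage, Set.mem_union, Set.mem_compl_iff, Set.mem_ofPred_eq, not_or,
      not_not] at hB'
    exact hω (orderFour_eq_exactAnswer hR hσ hs0 hs hq hB'.1 hB'.2.1 hB'.2.2)
  calc P.real {ω | orderFour R (ringTensor u + fun x => E x ω) (y ω) q ≠ some (exactAnswer τ q)}
      ≤ ∑ z, P.real (y ⁻¹' {z} ∩ (fun ω x => E x ω) ⁻¹' B z) :=
        (measureReal_mono hsub (measure_ne_top _ _)).trans (measureReal_biUnion_finset_le _ _)
    _ ≤ ∑ z, P.real (y ⁻¹' {z}) * (3 * Real.exp (-(t ^ 2 / 2))) := by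
        refine Finset.sum_le_sum fun z _ => ?_
        have h := hyE.measure_inter_preimage_eq_mul {z} (B z) (measurableSet_singleton z) (hBm z)
        rw [measureReal_def, h, ENNReal.toReal_mul]
        exact mul_le_mul_of_nonneg_left (hB z) ENNReal.toReal_nonneg
    _ = 3 * Real.exp (-(t ^ 2 / 2)) := by
        rw [← Finset.sum_mul, sum_measureReal_preimage_singleton _
          fun z _ => hy (measurableSet_singleton z)]
        simp

end Noise

/-- The ceiling costs at most one, which `log d ≥ 2 * log 2` absorbs. -/
theorem query_count_le {d : ℕ} (hd : 4 ≤ d) :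
    ((1 + (d - 4) * Nat.clog 2 d : ℕ) : ℝ) ≤ 3 * d * Real.log d := by
  have hd' : (4 : ℝ) ≤ d := by exact_mod_cast hd
  have hlog2 := Real.log_two_gt_d9
  have hlog4 : 2 * Real.log 2 ≤ Real.log d := by
    have : Real.log 4 = 2 * Real.log 2 := by
      rw [show (4 : ℝ) = 2 ^ 2 by norm_num, Real.log_pow]; norm_num
    rw [← this]
    exact Real.log_le_log (by norm_num) hd'
  have hclog : ((Nat.clog 2 d : ℕ) : ℝ) ≤ 3 * Real.log d := by
    have h1 : 2 ^ (Nat.clog 2 d).pred < d := Nat.pow_pred_clog_lt_self one_lt_two (by omega)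
    have h2 : ((2 : ℝ) ^ (Nat.clog 2 d).pred) ≤ d := by exact_mod_cast h1.le
    have h3 := Real.log_le_log (by positivity) h2
    rw [Real.log_pow] at h3
    have h4 : ((Nat.clog 2 d : ℕ) : ℝ) ≤ ((Nat.clog 2 d).pred : ℝ) + 1 := by
      exact_mod_cast Nat.le_succ_of_pred_le le_rfl
    have h5 : 0 ≤ ((Nat.clog 2 d).pred : ℝ) := Nat.cast_nonneg _
    nlinarith
  push_cast [Nat.cast_sub hd]
  nlinarith [mul_le_mul_of_nonneg_left hclog (by linarith : (0 : ℝ) ≤ (d : ℝ) - 4)]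

end TensorRing

end

/-! ### The union bound over the queries of the exact run. -/

theorem corollary4p6 :
    ∃ C : ℝ, 0 < C ∧
      ∀ (d : ℕ) (hd : 4 ≤ d) (n r : Fin d → ℕ) (τ : Equiv.Perm (Fin d))
        (u : TensorRing.Cores n r τ) (R : ℕ) (σ σe T : ℝ),
        TensorRing.AdmissibleRank n r R →
        0 < σ → TensorRing.UniformGap u R σ →
        0 < σe → T < σ / σe →
        ∀ (Ω : Type*) [MeasurableSpace Ω] (P : MeasureTheory.Measure Ω)
          [MeasureTheory.IsProbabilityMeasure P]
          (y : ℕ × ℕ → Ω → ∀ i, Fin (n i))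
          (E : ℕ × ℕ → (∀ i, Fin (n i)) → Ω → ℝ),
          (∀ c, Measurable (y c)) →
          (∀ c x, ProbabilityTheory.HasLaw (E c x)
            (ProbabilityTheory.gaussianReal 0 (σe ^ 2).toNNReal) P) →
          (∀ c, ProbabilityTheory.iIndepFun (E c) P) →
          (∀ c, ProbabilityTheory.IndepFun (y c) (fun ω x => E c x ω) P) →
          P.real {ω | ¬ TensorRing.IsCorrectOutput τ
              (TensorRing.noisyRun hd R (TensorRing.ringTensor u)
                (fun c => y c ω) (fun c x => E c x ω))} ≤
            C * d * Real.log d *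
              Real.exp (-(1 / 8) * max (T - 4 * (Finset.univ.sup n : ℕ)) 0 ^ 2) := by
  -- Three from the query count times three matricizations per query.
  refine ⟨9, by norm_num, ?_⟩
  intro d hd n r τ u R σ σe T hR _ hσ hσe hT Ω _ P _ y E hy hlaw hind hyE
  set m : ℕ := Finset.univ.sup n with hm
  have hnm : ∀ i, n i ≤ m := fun i => Finset.le_sup (Finset.mem_univ i)
  have hcount := TensorRing.query_count_le hd
  -- In the first case the exponential is one and `9 * d * log d ≥ 1`, so the bound is trivial.
  rcases le_or_gt (T - 4 * (m : ℝ)) 0 with hT0 | hT0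
  · rw [max_eq_right hT0]
    have h1 : (1 : ℝ) ≤ ((1 + (d - 4) * Nat.clog 2 d : ℕ) : ℝ) := by
      exact_mod_cast Nat.le_add_right 1 _
    have h2 := MeasureTheory.measureReal_le_one (μ := P) (s := {ω | ¬ TensorRing.IsCorrectOutput τ
      (TensorRing.noisyRun hd R (TensorRing.ringTensor u) (fun c => y c ω) (fun c x => E c x ω))})
    norm_num
    linarith
  rw [max_eq_left hT0.le]
  set t : ℝ := T / 2 - 2 * m with ht
  have ht0 : 0 < t := by rw [ht]; linarith
  have hs : 2 * (σe * (2 * m + t)) < σ := by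
    rw [lt_div_iff₀ hσe] at hT
    rw [ht]
    linarith
  obtain ⟨τ', hτ', Q, hQ, hQi, hrun⟩ := TensorRing.computes_recoverRing hd τ
  -- `Q` does not depend on `ω`, so an incorrect output forces a wrong answer to one of finitely
  -- many fixed queries.
  have hsub : {ω | ¬ TensorRing.IsCorrectOutput τ (TensorRing.noisyRun hd R
      (TensorRing.ringTensor u) (fun c => y c ω) (fun c x => E c x ω))} ⊆
      ⋃ p ∈ Q, {ω | TensorRing.orderFour R (TensorRing.ringTensor u + fun x => E p.1 x ω)
        (y p.1 ω) p.2 ≠ some (TensorRing.exactAnswer τ p.2)} := by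
    intro ω hω
    by_contra hcon
    simp only [Set.mem_iUnion, not_exists] at hcon
    exact hω ⟨τ', hτ', hrun _ fun p hp => not_not.1 (hcon p hp)⟩
  calc P.real _ ≤ ∑ p ∈ Q, P.real {ω | TensorRing.orderFour R
        (TensorRing.ringTensor u + fun x => E p.1 x ω) (y p.1 ω) p.2 ≠
          some (TensorRing.exactAnswer τ p.2)} :=
        (MeasureTheory.measureReal_mono hsub (MeasureTheory.measure_ne_top _ _)).trans (MeasureTheory.measureReal_biUnion_finset_le _ _)
    _ ≤ ∑ _p ∈ Q, 3 * Real.exp (-(t ^ 2 / 2)) := Finset.sum_le_sum fun p hp =>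
        TensorRing.prob_orderFour_ne_le hR hσ hσe (hlaw p.1) (hind p.1) (hy p.1) (hyE p.1) hnm ht0
          hs (hQi p hp)
    _ = Q.card * (3 * Real.exp (-(t ^ 2 / 2))) := by rw [Finset.sum_const, nsmul_eq_mul]
    _ ≤ (3 * d * Real.log d) * (3 * Real.exp (-(t ^ 2 / 2))) := by
        refine mul_le_mul_of_nonneg_right (le_trans ?_ hcount) (by positivity)
        exact_mod_cast hQ
    _ = _ := by
        have : -(t ^ 2 / 2) = -(1 / 8) * (T - 4 * (m : ℝ)) ^ 2 := by rw [ht]; ring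
        rw [this]; ring
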